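/- **Setting.** Let $X=\{\boldsymbol x_1,\dots,\boldsymbol x_N\}\subset\mathbb R^n$ be finite and $\epsilon\ge 0$. For a polynomial $h\in\mathbb R[x_1,\dots,x_n]$ put $h(X)=(h(\boldsymbol x_i))_i\in\mathbb R^N$ and $\mathfrak n_{\mathrm g}(h;X)=(\partial h/\partial x_k(\boldsymbol x_i))_{i,k}\in\mathbb R^{Nn}$; for a finite set $H$ of polynomials, $H(X)$ and $\mathfrak n_{\mathrm g}(H;X)$ are the matrices with these columns, $h\in H$, and $H\boldsymbol w=\sum_{h\in H}w_hh$. The *gradient-normalized VCA* on $(X,\epsilon)$ starts with $F_0=\{m\}$, $m\neq0$ a constant, and $G_0=\emptyset$. At step $t=1,2,\dots$ it takes $C_1^{\mathrm{pre}}=\{x_1,\dots,x_n\}$, or $C_t^{\mathrm{pre}}=\{pq: p\in F_1,\ q\in F_{t-1}\}$ if $t>1$, and, with $F^{t-1}=F_0\cup\dots\cup F_{t-1}$, the set $C_t$ of all $c-F^{t-1}F^{t-1}(X)^\dagger c(X)$, $c\in C_t^{\mathrm{pre}}$, where $\dagger$ is the Moore–Penrose pseudo-inverse. It solves $$C_t(X)^\top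 C_t(X)V=\mathfrak N_tV\Lambda,\qquad V^\top\mathfrak N_tV=I,\qquad \mathfrak N_t=\mathfrak n_{\mathrm g}(C_t;X)^\top\mathfrak n_{\mathrm g}(C_t;X),$$ where $V$ has $\operatorname{rank}\mathfrak N_t$ columns $\boldsymbol v_i$ (generalized eigenvectors of zero gradient norm are discarded) and $\Lambda=\operatorname{diag}(\lambda_i)$, and sets $F_t=\{C_t\boldsymbol v_i:\sqrt{\lambda_i}>\epsilon\}$, $G_t=\{C_t\boldsymbol v_i:\sqrt{\lambda_i}\le\epsilon\}$. It stops at the first step $T\ge 1$ with $F_T=\emptyset$ and returns $F=\bigcup_{t\le T}F_t$, $G=\bigcup_{t\le T}G_t$, graded by the steps $t$. As generalized eigenvectors are not unique, one input may have several outputs. A polynomial $\widehat h$ is *$(1,\alpha)$-degree-wise identical* to $h$ if $\widehat h=\sum_{\tau=0}^{\deg h}\alpha^{1-\tau}h^{(\tau)}$, where $h^{(\tau)}$ is the degree-$\tau$ part of $h$. **Theorem.** Let $\boldsymbol\beta\in\mathbb R^n$ and $\alpha\ne0$. Let $X-\boldsymbol\beta$ and $\alpha X$ be the sets of translated and scaled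 points. Consider outputs $(F,G)$ for $(X,\epsilon)$, $(\widetilde F,\widetilde G)$ for $(X-\boldsymbol\beta,\epsilon)$ and $(\widehat F,\widehat G)$ for $(\alpha X,|\alpha|\epsilon)$; the first two runs start with the same constant $m\ne0$, the third with any constant $\widehat m\neq 0$. 1. For all such outputs, the three runs stop at the same step $T$ and, for each $t$, the sets $G_t,\widetilde G_t,\widehat G_t$ have the same number of elements. 2. Likewise, for each $t$, the sets $F_t,\widetilde F_t,\widehat F_t$ have the same number of elements. 3. For every output $(F,G)$ for $(X,\epsilon)$ there is an output $(\widetilde F,\widetilde G)$ for $(X-\boldsymbol\beta,\epsilon)$, and for every $(\widetilde F,\widetilde G)$ there is an $(F,G)$, such that there are bijections $h\mapsto\widetilde h$ from $F_t$ to $\widetilde F_t$ and from $G_t$ to $\widetilde G_t$, for each $t$, with $\widetilde h(\boldsymbol x)=h(\boldsymbol x+\boldsymbol\beta)$. 4. For every output $(F,G)$ for $(X,\epsilon)$ there is an output $(\widehat F,\widehat G)$ for $(\alpha X,|\alpha|\epsilon)$, and for every $(\widehat F,\widehat G)$ there is an $(F,G)$, such that there are bijections $h\mapsto\widehat h$ from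 $F_t$ to $\widehat F_t$ and from $G_t$ to $\widehat G_t$, for each $t$, such that $\widehat h$ is $(1,\alpha)$-degree-wise identical to $h$ for all nonconstant $h$. For corresponding outputs as in 3 and 4, moreover, the stopping steps agree, and the returned sets $F$ and $\widetilde F$ (resp. $\widehat F$), and $G$ and $\widetilde G$ (resp. $\widehat G$), have the same number of elements of each total degree. -/

import Mathlib

open MvPolynomial Matrix

noncomputable section

namespace VCA

/-- `P` is a Moore–Penrose pseudo-inverse of the real matrix `A` (the four Penrose conditions). -/
structure IsPseudoInverse {k l : Type*} [Fintype k] [Fintype l]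
    (A : Matrix k l ℝ) (P : Matrix l k ℝ) : Prop where
  mul_mul_self : A * P * A = A
  self_mul_mul : P * A * P = P
  transpose_left : (A * P)ᵀ = A * P
  transpose_right : (P * A)ᵀ = P * A

theorem exists_isPseudoInverse {k l : Type*} [Fintype k] [Fintype l] (A : Matrix k l ℝ) :
    ∃ P : Matrix l k ℝ, IsPseudoInverse A P := by
  classical
  have hM : (Aᵀ * A).IsHermitian := by
    simpa using Matrix.isHermitian_conjTranspose_mul_self A
  set U : Matrix l l ℝ := hM.eigenvectorUnitary.1 with hU
  set d : l → ℝ := hM.eigenvalues with hd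
  have hUU : Uᵀ * U = 1 := by
    have h := (Matrix.mem_unitaryGroup_iff').1 hM.eigenvectorUnitary.2
    simpa [hU, Matrix.star_eq_conjTranspose] using h
  have hMU : Aᵀ * A = U * diagonal d * Uᵀ := by
    have h := hM.spectral_theorem
    simpa [Unitary.conjStarAlgAut_apply, Matrix.star_eq_conjTranspose, hU, hd,
      Function.comp_def] using h
  set Q : Matrix l l ℝ := U * diagonal (fun i => (d i)⁻¹) * Uᵀ with hQ
  have key : ∀ a b : l → ℝ, (U * diagonal a * Uᵀ) * (U * diagonal b * Uᵀ)
      = U * diagonal (fun i => a i * b i) * Uᵀ := by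
    intro a b
    calc (U * diagonal a * Uᵀ) * (U * diagonal b * Uᵀ)
        = U * diagonal a * (Uᵀ * U) * diagonal b * Uᵀ := by simp only [Matrix.mul_assoc]
      _ = _ := by rw [hUU, Matrix.mul_one, Matrix.mul_assoc U, Matrix.diagonal_mul_diagonal]
  have hQt : Qᵀ = Q := by
    simp [hQ, Matrix.transpose_mul, Matrix.mul_assoc]
  have hcomm : Q * (Aᵀ * A) = (Aᵀ * A) * Q := by
    rw [hMU, hQ, key, key]; simp only [mul_comm]
  have hMQM : (Aᵀ * A) * Q * (Aᵀ * A) = Aᵀ * A := by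
    rw [hMU, hQ, key, key]
    congr 3; funext i
    by_cases h : d i = 0 <;> simp [h]
  have hQMQ : Q * (Aᵀ * A) * Q = Q := by
    rw [hMU, hQ, key, key]
    congr 3; funext i
    by_cases h : d i = 0 <;> simp [h]
  have hE : A * (Q * (Aᵀ * A) - 1) = 0 := by
    have h0 : (Aᵀ * A) * (Q * (Aᵀ * A) - 1) = 0 := by
      rw [Matrix.mul_sub, ← Matrix.mul_assoc, hMQM]; simp
    have h1 : (A * (Q * (Aᵀ * A) - 1))ᴴ * (A * (Q * (Aᵀ * A) - 1)) = 0 := by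
      rw [Matrix.conjTranspose_mul, Matrix.mul_assoc, Matrix.conjTranspose_eq_transpose_of_trivial A,
        ← Matrix.mul_assoc Aᵀ, h0, Matrix.mul_zero]
    exact Matrix.conjTranspose_mul_self_eq_zero.1 h1
  refine ⟨Q * Aᵀ, ?_, ?_, ?_, ?_⟩
  · rw [Matrix.mul_sub, Matrix.mul_one, sub_eq_zero] at hE
    simpa only [Matrix.mul_assoc] using hE
  · have h := congrArg (fun Z => Z * Aᵀ) hQMQ
    simpa only [Matrix.mul_assoc] using h
  · simp [Matrix.transpose_mul, hQt, Matrix.mul_assoc]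
  · rw [Matrix.mul_assoc, Matrix.transpose_mul, hQt, hcomm]
    simp [Matrix.transpose_mul]

/-- The pseudo-inverse `A†`. -/
def pinv {k l : Type*} [Fintype k] [Fintype l] (A : Matrix k l ℝ) : Matrix l k ℝ :=
  Classical.choose (exists_isPseudoInverse A)

theorem isPseudoInverse_pinv {k l : Type*} [Fintype k] [Fintype l] (A : Matrix k l ℝ) :
    IsPseudoInverse A (pinv A) :=
  Classical.choose_spec (exists_isPseudoInverse A)

theorem IsPseudoInverse.unique {k l : Type*} [Fintype k] [Fintype l] {A : Matrix k l ℝ}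
    {P Q : Matrix l k ℝ} (hP : IsPseudoInverse A P) (hQ : IsPseudoInverse A Q) : P = Q := by
  have h1 : A * P = A * Q := by
    calc A * P = (A * P)ᵀ := hP.transpose_left.symm
      _ = (A * Q * A * P)ᵀ := by rw [hQ.mul_mul_self]
      _ = (A * P)ᵀ * (A * Q)ᵀ := by rw [← Matrix.transpose_mul, ← Matrix.mul_assoc]
      _ = A * P * (A * Q) := by rw [hP.transpose_left, hQ.transpose_left]
      _ = A * Q := by rw [← Matrix.mul_assoc, hP.mul_mul_self]
  have h2 : P * A = Q * A := by
    calc P * A = (P * A)ᵀ := hP.transpose_right.symm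
      _ = (P * (A * Q * A))ᵀ := by rw [hQ.mul_mul_self]
      _ = (Q * A)ᵀ * (P * A)ᵀ := by
          rw [← Matrix.transpose_mul]; simp only [Matrix.mul_assoc]
      _ = Q * A * (P * A) := by rw [hP.transpose_right, hQ.transpose_right]
      _ = Q * (A * P * A) := by simp only [Matrix.mul_assoc]
      _ = Q * A := by rw [hP.mul_mul_self]
  calc P = P * A * P := hP.self_mul_mul.symm
    _ = Q * A * Q := by rw [h2, Matrix.mul_assoc, h1, ← Matrix.mul_assoc]
    _ = Q := hQ.self_mul_mul

/-- The polynomial ring `ℝ[x₁, …, xₙ]`. -/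
abbrev Poly (n : ℕ) := MvPolynomial (Fin n) ℝ

section Data

variable {n : ℕ} {ι : Type*} [Fintype ι] (X : ι → Fin n → ℝ)

/-- The evaluation vector `h(X)` of a polynomial at the points `X = {xᵢ}`. -/
def evalVec (h : Poly n) : ι → ℝ := fun i => eval (X i) h

/-- The evaluation matrix `H(X)`; its columns are the evaluation vectors of the elements of `H`. -/
def evalMatrix (H : Finset (Poly n)) : Matrix ι H ℝ :=
  Matrix.of fun i h => evalVec X (h : Poly n) i

/-- The gradient map: the vector of all partial derivatives of `h` at all points of `X`. -/
def gradVec (h : Poly n) : ι × Fin n → ℝ := fun p => eval (X p.1) (pderiv p.2 h)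

/-- The matrix whose columns are the gradient vectors of the elements of `H`. -/
def gradMatrix (H : Finset (Poly n)) : Matrix (ι × Fin n) H ℝ :=
  Matrix.of fun p h => gradVec X (h : Poly n) p

/-- The normalization matrix of the gradient normalization. -/
def normMatrix (H : Finset (Poly n)) : Matrix H H ℝ := (gradMatrix X H)ᵀ * gradMatrix X H

/-- The linear combination `H w = ∑ w_h h`. -/
def comb (H : Finset (Poly n)) (w : H → ℝ) : Poly n := ∑ h : H, w h • (h : Poly n)

/-- `F^t`: all polynomials that were put into `F` in the steps `0, …, t`. -/
def upTo (F : ℕ → Finset (Poly n)) (t : ℕ) : Finset (Poly n) :=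
  open Classical in (Finset.range (t + 1)).biUnion F

/-- The pre-candidates of step `t`: the variables for `t = 1`, the products `pq` with
`p ∈ F₁`, `q ∈ F_{t-1}` for `t > 1` (there is no step `0`). -/
def preCandidates (F : ℕ → Finset (Poly n)) : ℕ → Finset (Poly n)
  | 0 => ∅
  | 1 => open Classical in Finset.univ.image fun i : Fin n => (MvPolynomial.X i : Poly n)
  | t + 2 => open Classical in Finset.image₂ (fun p q => p * q) (F 1) (F (t + 1))

/-- The orthogonal projection `c - H H(X)† c(X)`. -/
def orthProj (H : Finset (Poly n)) (c : Poly n) : Poly n :=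
  c - comb H (pinv (evalMatrix X H) *ᵥ evalVec X c)

/-- The candidates `C_t = C_t^pre - F^{t-1} F^{t-1}(X)† C_t^pre(X)` of step `t ≥ 1`. -/
def candidates (F : ℕ → Finset (Poly n)) (t : ℕ) : Finset (Poly n) :=
  open Classical in (preCandidates F t).image (orthProj X (upTo F (t - 1)))

/-- The columns of `V` form a complete system of generalized eigenvectors of nonzero gradient norm,
with eigenvalues `lam`, of `C(X)ᵀ C(X) V = 𝔑(C) V Λ`, normalized by `Vᵀ 𝔑(C) V = 1`.
There are `rank 𝔑(C)` of them (all of `|C|` if `𝔑(C)` is regular). -/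
structure SolvesGEP (C : Finset (Poly n)) (V : Matrix C (Fin (normMatrix X C).rank) ℝ)
    (lam : Fin (normMatrix X C).rank → ℝ) : Prop where
  eigen : (evalMatrix X C)ᵀ * evalMatrix X C * V = normMatrix X C * V * diagonal lam
  normalized : Vᵀ * normMatrix X C * V = 1

/-- Solve the generalized eigenvalue problem for the candidate set `C` and sort the polynomials
`C vᵢ` into `F` if `√λᵢ > ε` and into `G` if `√λᵢ ≤ ε`. The eigenvectors are not unique, so that
this is a relation. -/
def IsSplit (ε : ℝ) (C F G : Finset (Poly n)) : Prop :=
  open Classical in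
  ∃ (V : Matrix C (Fin (normMatrix X C).rank) ℝ) (lam : Fin (normMatrix X C).rank → ℝ),
    SolvesGEP X C V lam ∧
    F = (Finset.univ.filter fun i => ε < √(lam i)).image (fun i => comb C (V.col i)) ∧
    G = (Finset.univ.filter fun i => √(lam i) ≤ ε).image (fun i => comb C (V.col i))

end Data

/-- What a run of the algorithm leaves behind: the step `T` at which it stops and the sets
`F_t`, `G_t` built at the steps `t ≤ T`. -/
structure Output (n : ℕ) where
  T : ℕ
  F : ℕ → Finset (Poly n)
  G : ℕ → Finset (Poly n)

/-- The returned set `F = F^T`. -/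
def Output.allF {n : ℕ} (R : Output n) : Finset (Poly n) := upTo R.F R.T

/-- The returned set `G = G^T`. -/
def Output.allG {n : ℕ} (R : Output n) : Finset (Poly n) := upTo R.G R.T

/-- `R` is an output of the gradient-normalized VCA for the points `X` and the threshold `ε`,
started with the constant polynomial `m`. (The sets `F_t`, `G_t` with `t > T` are never built and
are set to `∅`.) -/
structure IsOutput {n : ℕ} {ι : Type*} [Fintype ι] (X : ι → Fin n → ℝ) (ε m : ℝ)
    (R : Output n) : Prop where
  F_zero : R.F 0 = {C m}
  G_zero : R.G 0 = ∅
  one_le : 1 ≤ R.T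
  step : ∀ t, 1 ≤ t → t ≤ R.T → IsSplit X ε (candidates X R.F t) (R.F t) (R.G t)
  continues : ∀ t, 1 ≤ t → t < R.T → R.F t ≠ ∅
  stops : R.F R.T = ∅
  after : ∀ t, R.T < t → R.F t = ∅ ∧ R.G t = ∅

/-- `h'` is `(t, α)`-degree-wise identical to `h`: `h' = ∑_τ α^(t-τ) h^(τ)`, where `h^(τ)` is the
part of `h` of degree `τ`. -/
def IsDegreewiseIdentical {n : ℕ} (t : ℤ) (α : ℝ) (h' h : Poly n) : Prop :=
  h' = ∑ τ ∈ Finset.range (h.totalDegree + 1), α ^ (t - (τ : ℤ)) • homogeneousComponent τ h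

/-- `h'(x) = h(x + β)`. -/
def IsTranslate {n : ℕ} (β : Fin n → ℝ) (h' h : Poly n) : Prop :=
  h' = aeval (fun i => (MvPolynomial.X i + C (β i) : Poly n)) h

/-- Two outputs have the same number of polynomials in `F` and in `G` at each step (the step `t`
is the degree at which the algorithm builds `F_t` and `G_t`), and stop at the same step. -/
structure SameStepCounts {n : ℕ} (R R' : Output n) : Prop where
  T_eq : R'.T = R.T
  card_F : ∀ t, (R'.F t).card = (R.F t).card
  card_G : ∀ t, (R'.G t).card = (R.G t).card

/-- The returned sets of two outputs have the same number of elements of each total degree. -/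
structure SameDegreeCounts {n : ℕ} (R R' : Output n) : Prop where
  card_F : ∀ d, (R'.allF.filter fun h => h.totalDegree = d).card
    = (R.allF.filter fun h => h.totalDegree = d).card
  card_G : ∀ d, (R'.allG.filter fun h => h.totalDegree = d).card
    = (R.allG.filter fun h => h.totalDegree = d).card

/-- The outputs `R` and `R'` correspond: they stop at the same step, their polynomials are matched
one-to-one step by step, `F` with `F` and `G` with `G`, in such a way that matched polynomials
`h` of `R` and `h'` of `R'` satisfy `rel h' h`, and the returned sets have the same number of
elements of each degree. -/
structure Corresponds {n : ℕ} (rel : Poly n → Poly n → Prop) (R R' : Output n) : Prop where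
  T_eq : R'.T = R.T
  matchF : ∀ t, ∃ e : R.F t ≃ R'.F t, ∀ h : R.F t, rel (e h : Poly n) (h : Poly n)
  matchG : ∀ t, ∃ e : R.G t ≃ R'.G t, ∀ h : R.G t, rel (e h : Poly n) (h : Poly n)
  sameDegreeCounts : SameDegreeCounts R R'

end VCA

end

noncomputable section

namespace VCA

set_option linter.unusedSectionVars false

/-! Translation and scaling are both cases of `x ↦ α(x - β)` on the points, and the map `h ↦ α
h(α⁻¹x + β)` on polynomials goes with it: it multiplies values at corresponding points by `α` and
leaves gradients unchanged. Evaluation inner products thus gain `α²` and gradient inner products are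
preserved, so eigenvectors go to eigenvectors and `√λ` scales by `|α|`, as the threshold does
(`IsSpanSplit.affine`). A step depends on its candidates only through their span (`isSplit_iff`).
The projection depends only on the span projected off, because the evaluation form is definite on
the span of `F^t` (`IsOutput.evalDefinite`, `orthProj_eq_of_orthogonal`). Hence the constants `αβᵢ`
added to the variables and the factors `α` in products are harmless, and outputs are carried to
outputs (`IsOutput.map_affineRescale`); the inverse map gives the converse.

For the counts it remains to compare two outputs for one input. Eigenvectors are determined only up
to a basis change within eigenspaces and up to the space `J` of polynomials vanishing on `X`
together with their gradients. Neither form sees `J`, and `J` absorbs products. Modulo `J`, the span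
of `F_t` is the sum of the eigenspaces above the threshold (`IsSpanSplit.span_sup_eq`), and
projections respect congruence modulo `J` (`orthProj_congr`), so by induction the spans of `F_t`
agree modulo `J`. Cardinalities are gradient ranks, which ignore `J` (`IsOutput.sameStepCounts`). -/

/-- The symmetric bilinear form `(p, q) ↦ ⟨f p, f q⟩` induced by a linear map into coordinates. -/
def dotForm {E κ : Type*} [AddCommGroup E] [Module ℝ E] [Fintype κ] (f : E →ₗ[ℝ] κ → ℝ) :
    E →ₗ[ℝ] E →ₗ[ℝ] ℝ :=
  LinearMap.mk₂ ℝ (fun p q => f p ⬝ᵥ f q)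
    (fun p q r => by simp [add_dotProduct]) (fun a p q => by simp)
    (fun p q r => by simp [dotProduct_add]) (fun a p q => by simp)

/-! ### Orthonormal families for a degenerate inner product. -/

section DotForm

variable {E κ : Type*} [AddCommGroup E] [Module ℝ E] [Fintype κ] (f : E →ₗ[ℝ] κ → ℝ)

theorem dotForm_apply (p q : E) : dotForm f p q = f p ⬝ᵥ f q := rfl

theorem dotForm_comm (p q : E) : dotForm f p q = dotForm f q p := dotProduct_comm _ _

theorem dotForm_self_eq_zero {p : E} : dotForm f p p = 0 ↔ f p = 0 := dotProduct_self_eq_zero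

theorem dotForm_self_nonneg (p : E) : 0 ≤ dotForm f p p :=
  Finset.sum_nonneg fun _ _ => mul_self_nonneg _

theorem dotForm_eq_zero_of_left {p : E} (h : f p = 0) (q : E) : dotForm f p q = 0 := by
  simp [dotForm_apply, h]

theorem dotForm_eq_zero_of_right {q : E} (h : f q = 0) (p : E) : dotForm f p q = 0 := by
  simp [dotForm_apply, h]

/-- An orthonormal family in a space of the same dimension is complete. -/
theorem eq_zero_of_dotForm_orthonormal {U : Submodule ℝ E} {r : ℕ}
    (hr : r = Module.finrank ℝ (U.map f)) {h : Fin r → E} (hU : ∀ i, h i ∈ U)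
    (ho : ∀ i j, dotForm f (h i) (h j) = if i = j then 1 else 0) {u : E} (hu : u ∈ U)
    (hz : ∀ i, dotForm f (h i) u = 0) : f u = 0 := by
  let w : Fin r → U.map f := fun i => ⟨f (h i), Submodule.mem_map_of_mem (hU i)⟩
  have hli : LinearIndependent ℝ w := by
    rw [Fintype.linearIndependent_iff]
    intro g hg i
    have h1 : ∑ j, g j • f (h j) = 0 := by
      simpa [w] using congrArg Subtype.val hg
    have h2 : dotForm f (h i) (∑ j, g j • h j) = 0 :=
      dotForm_eq_zero_of_right f (by simpa using h1) _
    simpa [ho] using h2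
  have hspan : Submodule.span ℝ (Set.range w) = ⊤ :=
    hli.span_eq_top_of_card_eq_finrank' (by simpa using hr)
  have hmem : (⟨f u, Submodule.mem_map_of_mem hu⟩ : U.map f) ∈ Submodule.span ℝ (Set.range w) := by
    rw [hspan]; trivial
  obtain ⟨g, hg⟩ := (Submodule.mem_span_range_iff_exists_fun ℝ).1 hmem
  have h1 : ∑ j, g j • f (h j) = f u := by
    simpa [w] using congrArg Subtype.val hg
  -- `f u` is a combination of the `f (h j)`, all of which are orthogonal to it.
  rw [← dotProduct_self_eq_zero]
  nth_rewrite 1 [← h1]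
  rw [sum_dotProduct]
  refine Finset.sum_eq_zero fun i _ => ?_
  rw [smul_dotProduct, ← dotForm_apply, hz, smul_zero]

/-- Orthonormality makes the images under `f` independent. This turns a count of eigenvectors into
an invariant of a span. -/
theorem finrank_map_span_of_orthonormal {S : Finset E}
    (ho : ∀ p ∈ S, dotForm f p p = 1) (hz : ∀ p ∈ S, ∀ q ∈ S, p ≠ q → dotForm f p q = 0) :
    Module.finrank ℝ ((Submodule.span ℝ (S : Set E)).map f) = S.card := by
  have hli : LinearIndependent ℝ (fun p : S => f p) := by
    classical
    rw [Fintype.linearIndependent_iff]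
    intro g hg i
    have h2 : dotForm f i (∑ j : S, g j • (j : E)) = 0 :=
      dotForm_eq_zero_of_right f (by simpa using hg) _
    rw [map_sum, Finset.sum_eq_single i] at h2
    · simpa [ho i i.2] using h2
    · intro j _ hj
      rw [map_smul, hz i i.2 j j.2 (fun h => hj (Subtype.ext h.symm)), smul_zero]
    · simp
  have hS : f '' (S : Set E) = Set.range (fun p : S => f p) := by ext; simp
  rw [Submodule.map_span, hS, finrank_span_eq_card hli, Fintype.card_coe]

end DotForm

/-! ### The generalized eigenvalue problem without coordinates. -/

section Forms

variable {n : ℕ} {ι : Type*} [Fintype ι] (X : ι → Fin n → ℝ)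

/-- `evalVec` as a linear map. -/
def evalLin : Poly n →ₗ[ℝ] ι → ℝ where
  toFun := evalVec X
  map_add' p q := by ext; simp [evalVec]
  map_smul' a p := by ext; simp [evalVec, smul_eval]

/-- `gradVec` as a linear map. -/
def gradLin : Poly n →ₗ[ℝ] ι × Fin n → ℝ where
  toFun := gradVec X
  map_add' p q := by ext; simp [gradVec]
  map_smul' a p := by ext; simp [gradVec, smul_eval]

theorem evalLin_apply (p : Poly n) (i : ι) : evalLin X p i = eval (X i) p := rfl

theorem gradLin_apply (p : Poly n) (i : ι × Fin n) :
    gradLin X p i = eval (X i.1) (pderiv i.2 p) := rfl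

/-- The inner product of evaluation vectors. -/
abbrev evalForm : Poly n →ₗ[ℝ] Poly n →ₗ[ℝ] ℝ := dotForm (evalLin X)

/-- The inner product of gradient vectors. -/
abbrev gradForm : Poly n →ₗ[ℝ] Poly n →ₗ[ℝ] ℝ := dotForm (gradLin X)

theorem mulVec_of_columns {κ : Type*} (f : Poly n →ₗ[ℝ] κ → ℝ) (H : Finset (Poly n)) (w : H → ℝ) :
    (Matrix.of fun i (h : H) => f h i) *ᵥ w = f (comb H w) := by
  ext i
  simp [comb, mulVec, dotProduct, mul_comm]

theorem evalMatrix_mulVec (H : Finset (Poly n)) (w : H → ℝ) :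
    evalMatrix X H *ᵥ w = evalLin X (comb H w) :=
  mulVec_of_columns (evalLin X) H w

theorem comb_mem_span (H : Finset (Poly n)) (w : H → ℝ) :
    comb H w ∈ Submodule.span ℝ (H : Set (Poly n)) :=
  Submodule.sum_mem _ fun h _ => Submodule.smul_mem _ _ (Submodule.subset_span h.2)

theorem exists_comb_eq {H : Finset (Poly n)} {p : Poly n}
    (hp : p ∈ Submodule.span ℝ (H : Set (Poly n))) : ∃ w : H → ℝ, comb H w = p := by
  have : (H : Set (Poly n)) = Set.range (fun h : H => (h : Poly n)) := by ext; simp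
  rw [this] at hp
  exact (Submodule.mem_span_range_iff_exists_fun ℝ).1 hp

theorem gram_mul_apply {κ : Type*} [Fintype κ] (f : Poly n →ₗ[ℝ] κ → ℝ) (H : Finset (Poly n))
    {ρ : Type*} (V : Matrix H ρ ℝ) (c : H) (i : ρ) :
    ((Matrix.of fun i (h : H) => f h i)ᵀ * (Matrix.of fun i (h : H) => f h i) * V) c i
      = dotForm f c (comb H (V.col i)) := by
  rw [Matrix.mul_assoc, dotForm_apply, ← mulVec_of_columns]
  rfl

theorem evalGram_mul_apply (H : Finset (Poly n)) {ρ : Type*} (V : Matrix H ρ ℝ) (c : H) (i : ρ) :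
    ((evalMatrix X H)ᵀ * evalMatrix X H * V) c i = evalForm X c (comb H (V.col i)) :=
  gram_mul_apply (evalLin X) H V c i

theorem normMatrix_mul_apply (H : Finset (Poly n)) {ρ : Type*} (V : Matrix H ρ ℝ) (c : H) (i : ρ) :
    (normMatrix X H * V) c i = gradForm X c (comb H (V.col i)) :=
  gram_mul_apply (gradLin X) H V c i

theorem rank_normMatrix (H : Finset (Poly n)) :
    (normMatrix X H).rank
      = Module.finrank ℝ ((Submodule.span ℝ (H : Set (Poly n))).map (gradLin X)) := by
  have hH : Set.range (gradMatrix X H).col = gradLin X '' (H : Set (Poly n)) := by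
    ext v
    constructor
    · rintro ⟨h, rfl⟩; exact ⟨h, h.2, rfl⟩
    · rintro ⟨h, hh, rfl⟩; exact ⟨⟨h, hh⟩, rfl⟩
  rw [normMatrix, Matrix.rank_transpose_mul_self, Matrix.rank_eq_finrank_span_cols,
    Submodule.map_span, hH]

/-- A complete system of generalized eigenvectors of `evalForm` with respect to `gradForm` on the
space `U` of polynomials. -/
structure IsEigensystem (U : Submodule ℝ (Poly n)) {r : ℕ} (h : Fin r → Poly n)
    (lam : Fin r → ℝ) : Prop where
  rank_eq : r = Module.finrank ℝ (U.map (gradLin X))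
  mem : ∀ i, h i ∈ U
  eigen : ∀ i, ∀ c ∈ U, evalForm X c (h i) = lam i * gradForm X c (h i)
  orthonormal : ∀ i j, gradForm X (h i) (h j) = if i = j then 1 else 0

/-- `IsSplit` in terms of the space spanned by the candidates. -/
def IsSpanSplit (ε : ℝ) (U : Submodule ℝ (Poly n)) (F G : Finset (Poly n)) : Prop :=
  open Classical in
  ∃ (r : ℕ) (h : Fin r → Poly n) (lam : Fin r → ℝ), IsEigensystem X U h lam ∧
    F = (Finset.univ.filter fun i => ε < √(lam i)).image h ∧
    G = (Finset.univ.filter fun i => √(lam i) ≤ ε).image h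

/-- The rows of the matrix equation test the eigenvector identity on the candidates; linearity
extends it to their span. -/
theorem solvesGEP_iff {H : Finset (Poly n)} (V : Matrix H (Fin (normMatrix X H).rank) ℝ)
    (lam : Fin (normMatrix X H).rank → ℝ) :
    SolvesGEP X H V lam ↔
      IsEigensystem X (Submodule.span ℝ (H : Set (Poly n))) (fun i => comb H (V.col i)) lam := by
  have hnorm : ∀ i j, (Vᵀ * normMatrix X H * V) i j
      = gradForm X (comb H (V.col i)) (comb H (V.col j)) := by
    intro i j
    rw [Matrix.mul_assoc, Matrix.mul_apply, comb, map_sum, LinearMap.sum_apply]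
    refine Finset.sum_congr rfl fun c _ => ?_
    rw [normMatrix_mul_apply, map_smul, LinearMap.smul_apply]
    rfl
  constructor
  · intro hV
    refine ⟨rank_normMatrix X H, fun i => comb_mem_span _ _, fun i c hc => ?_, fun i j => ?_⟩
    · induction hc using Submodule.span_induction with
      | mem c hc =>
        have := congrFun (congrFun hV.eigen ⟨c, hc⟩) i
        rw [evalGram_mul_apply, Matrix.mul_diagonal, normMatrix_mul_apply, mul_comm] at this
        exact this
      | zero => simp
      | add x y _ _ hx hy => simp only [map_add, LinearMap.add_apply, hx, hy, mul_add]
      | smul a x _ hx =>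
        simp only [map_smul, LinearMap.smul_apply, hx, smul_eq_mul]; ring
    · rw [← hnorm, hV.normalized, Matrix.one_apply]
  · intro hV
    refine ⟨?_, ?_⟩
    · ext c i
      rw [evalGram_mul_apply, Matrix.mul_diagonal, normMatrix_mul_apply, mul_comm]
      exact hV.eigen i c (Submodule.subset_span c.2)
    · ext i j
      rw [hnorm, hV.orthonormal, Matrix.one_apply]

/-- This frees the argument from the candidate set itself, which may be linearly dependent and is
not preserved by affine maps. -/
theorem isSplit_iff (ε : ℝ) (H F G : Finset (Poly n)) :
    IsSplit X ε H F G ↔ IsSpanSplit X ε (Submodule.span ℝ (H : Set (Poly n))) F G := by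
  constructor
  · rintro ⟨V, lam, hV, hF, hG⟩
    exact ⟨_, _, lam, (solvesGEP_iff X V lam).1 hV, hF, hG⟩
  · rintro ⟨r, h, lam, hh, hF, hG⟩
    have hr := hh.rank_eq
    rw [← rank_normMatrix] at hr
    subst hr
    -- Coordinates need not be unique when the candidates are dependent; any choice works.
    choose w hw using fun i => exists_comb_eq (hh.mem i)
    obtain rfl : (fun i => comb H (w i)) = h := funext hw
    exact ⟨Matrix.of fun c i => w i c, lam, (solvesGEP_iff X _ lam).2 hh, hF, hG⟩

variable {X}

theorem IsEigensystem.injective {U : Submodule ℝ (Poly n)} {r : ℕ} {h : Fin r → Poly n}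
    {lam : Fin r → ℝ} (H : IsEigensystem X U h lam) : Function.Injective h := by
  intro i j hij
  have h1 := H.orthonormal i j
  rw [← hij, H.orthonormal i i] at h1
  by_contra hne
  simp [hne] at h1

section Split

variable {ε : ℝ} {U : Submodule ℝ (Poly n)} {F G : Finset (Poly n)}

theorem IsSpanSplit.left_subset (h : IsSpanSplit X ε U F G) : (F : Set (Poly n)) ⊆ U := by
  obtain ⟨r, h, lam, H, rfl, rfl⟩ := h
  intro p hp
  simp only [Finset.coe_image, Set.mem_image] at hp
  obtain ⟨i, _, rfl⟩ := hp
  exact H.mem i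

theorem IsSpanSplit.gradForm_self (h : IsSpanSplit X ε U F G) {p : Poly n} (hp : p ∈ F ∨ p ∈ G) :
    gradForm X p p = 1 := by
  obtain ⟨r, h, lam, H, rfl, rfl⟩ := h
  simp only [Finset.mem_image] at hp
  obtain ⟨i, _, rfl⟩ | ⟨i, _, rfl⟩ := hp <;> simp [H.orthonormal]

/-- Unit gradient norm excludes constants, so the only constant in an output is the starting one. -/
theorem IsSpanSplit.totalDegree_ne_zero (h : IsSpanSplit X ε U F G) {p : Poly n}
    (hp : p ∈ F ∨ p ∈ G) : p.totalDegree ≠ 0 := by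
  intro h0
  have h1 := h.gradForm_self hp
  rw [(totalDegree_eq_zero_iff_eq_C).1 h0] at h1
  rw [dotForm_eq_zero_of_left] at h1
  · simp at h1
  · ext i; simp [gradLin_apply]

/-- `evalForm` is definite on the span of `F`. -/
theorem IsSpanSplit.eq_zero_of_evalForm_self (hε : 0 ≤ ε) (h : IsSpanSplit X ε U F G) {p : Poly n}
    (hp : p ∈ Submodule.span ℝ (F : Set (Poly n))) (h0 : evalForm X p p = 0) : p = 0 := by
  obtain ⟨r, h, lam, H, rfl, rfl⟩ := h
  obtain ⟨w, rfl⟩ := exists_comb_eq hp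
  refine Finset.sum_eq_zero fun q _ => ?_
  obtain ⟨i, hi, hiq⟩ := Finset.mem_image.1 q.2
  -- Membership in `F` means `√λ > ε ≥ 0`.
  have hlam : lam i ≠ 0 := by
    intro h0
    simp only [Finset.mem_filter, h0, Real.sqrt_zero] at hi
    exact absurd hi.2 (not_lt.2 hε)
  -- Zero evaluation norm forces evaluation-orthogonality to `q`; the eigenvector identity and
  -- orthonormality turn this into `λ * w q = 0`.
  have h2 : evalForm X (q : Poly n) (comb _ w) = 0 :=
    dotForm_eq_zero_of_right _ ((dotForm_self_eq_zero _).1 h0) _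
  rw [dotForm_comm, ← hiq, H.eigen i, hiq] at h2
  · have h3 := (mul_eq_zero.1 h2).resolve_left hlam
    rw [comb, map_sum, LinearMap.sum_apply, Finset.sum_eq_single q] at h3
    · rw [map_smul, LinearMap.smul_apply, ← hiq, H.orthonormal] at h3
      simp at h3
      simp [h3]
    · intro q' _ hne
      obtain ⟨j, hj, hjq⟩ := Finset.mem_image.1 q'.2
      rw [map_smul, LinearMap.smul_apply, ← hiq, ← hjq, H.orthonormal, if_neg, smul_zero]
      rintro rfl
      exact hne (Subtype.ext (hjq.symm.trans hiq))
    · simp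
  · refine Submodule.span_le.2 ?_ hp
    intro q hq
    obtain ⟨i, _, rfl⟩ := Finset.mem_image.1 (Finset.mem_coe.1 hq)
    exact H.mem i

theorem IsSpanSplit.card_left (h : IsSpanSplit X ε U F G) :
    F.card = Module.finrank ℝ ((Submodule.span ℝ (F : Set (Poly n))).map (gradLin X)) := by
  refine (finrank_map_span_of_orthonormal _ (fun p hp => h.gradForm_self (.inl hp)) ?_).symm
  obtain ⟨r, h, lam, H, rfl, rfl⟩ := h
  intro p hp q hq hne
  obtain ⟨i, _, rfl⟩ := Finset.mem_image.1 hp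
  obtain ⟨j, _, rfl⟩ := Finset.mem_image.1 hq
  rw [H.orthonormal, if_neg]
  rintro rfl
  exact hne rfl

theorem IsSpanSplit.card_add_card (h : IsSpanSplit X ε U F G) :
    F.card + G.card = Module.finrank ℝ (U.map (gradLin X)) := by
  obtain ⟨r, h, lam, H, rfl, rfl⟩ := h
  rw [← H.rank_eq, Finset.card_image_of_injective _ H.injective,
    Finset.card_image_of_injective _ H.injective]
  -- Makes the condition for `G` the negation of the one for `F`.
  simp only [← not_lt]
  rw [Finset.card_filter_add_card_filter_not, Finset.card_fin]

end Split

end Forms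


/-! ### Orthogonal projection and definiteness along a run. -/

section Projection

variable {n : ℕ} {ι : Type*} [Fintype ι] (X : ι → Fin n → ℝ)

/-- `evalForm` is positive definite on `U`. -/
def EvalDefinite (U : Submodule ℝ (Poly n)) : Prop :=
  ∀ u ∈ U, evalForm X u u = 0 → u = 0

theorem sub_orthProj_mem (H : Finset (Poly n)) (c : Poly n) :
    c - orthProj X H c ∈ Submodule.span ℝ (H : Set (Poly n)) := by
  rw [orthProj, sub_sub_cancel]
  exact comb_mem_span _ _

/-- With `A = H(X)`, the Penrose conditions give `Aᵀ A A† = Aᵀ`, so the residual is orthogonal to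
the columns of `A`. -/
theorem evalForm_orthProj (H : Finset (Poly n)) (c : Poly n) {u : Poly n}
    (hu : u ∈ Submodule.span ℝ (H : Set (Poly n))) : evalForm X u (orthProj X H c) = 0 := by
  obtain ⟨w, rfl⟩ := exists_comb_eq hu
  have hP := isPseudoInverse_pinv (evalMatrix X H)
  have h1 : (evalMatrix X H)ᵀ * (evalMatrix X H * pinv (evalMatrix X H)) = (evalMatrix X H)ᵀ := by
    rw [← hP.transpose_left, ← Matrix.transpose_mul, hP.mul_mul_self]
  have h2 : evalLin X (orthProj X H c)
      = evalLin X c - (evalMatrix X H * pinv (evalMatrix X H)) *ᵥ evalLin X c := by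
    rw [orthProj, map_sub, ← evalMatrix_mulVec, mulVec_mulVec]
    rfl
  rw [dotForm_apply, ← evalMatrix_mulVec, ← vecMul_transpose, ← dotProduct_mulVec, h2, mulVec_sub,
    mulVec_mulVec, h1, sub_self, dotProduct_zero]

variable {X}

/-- Two such residuals differ by an element of the span orthogonal to itself, which definiteness
kills. Thus the polynomial, not only its values, depends on nothing but the span of `H`. -/
theorem orthProj_eq_of_orthogonal {H : Finset (Poly n)} {c d : Poly n}
    (hH : EvalDefinite X (Submodule.span ℝ (H : Set (Poly n))))
    (hd : c - d ∈ Submodule.span ℝ (H : Set (Poly n)))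
    (ho : ∀ u ∈ Submodule.span ℝ (H : Set (Poly n)), evalForm X u d = 0) :
    orthProj X H c = d := by
  have hmem : orthProj X H c - d ∈ Submodule.span ℝ (H : Set (Poly n)) := by
    have := Submodule.sub_mem _ hd (sub_orthProj_mem X H c)
    rwa [sub_sub_sub_cancel_left] at this
  rw [← sub_eq_zero]
  refine hH _ hmem ?_
  rw [map_sub (evalForm X _), evalForm_orthProj X H c hmem, ho _ hmem, sub_zero]

theorem span_upTo_zero (F : ℕ → Finset (Poly n)) :
    Submodule.span ℝ (upTo F 0 : Set (Poly n)) = Submodule.span ℝ (F 0 : Set (Poly n)) := by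
  simp [upTo]

theorem span_upTo_succ (F : ℕ → Finset (Poly n)) (t : ℕ) :
    Submodule.span ℝ (upTo F (t + 1) : Set (Poly n))
      = Submodule.span ℝ (upTo F t : Set (Poly n))
        ⊔ Submodule.span ℝ (F (t + 1) : Set (Poly n)) := by
  classical
  rw [← Submodule.span_union]
  congr 1
  ext p
  simp [upTo, Finset.range_add_one (n := t + 1), or_comm]

theorem candidates_orthogonal (F : ℕ → Finset (Poly n)) (t : ℕ) {u c : Poly n}
    (hu : u ∈ Submodule.span ℝ (upTo F (t - 1) : Set (Poly n)))
    (hc : c ∈ Submodule.span ℝ (candidates X F t : Set (Poly n))) : evalForm X u c = 0 := by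
  induction hc using Submodule.span_induction with
  | mem c hc =>
    obtain ⟨p, _, rfl⟩ := Finset.mem_image.1 (Finset.mem_coe.1 hc)
    exact evalForm_orthProj X _ p hu
  | zero => simp
  | add x y _ _ hx hy => rw [map_add, hx, hy, add_zero]
  | smul a x _ hx => rw [map_smul, hx, smul_zero]

theorem evalDefinite_span_C [Nonempty ι] (m : ℝ) :
    EvalDefinite X (Submodule.span ℝ {(C m : Poly n)}) := by
  intro u hu h0
  obtain ⟨a, rfl⟩ := Submodule.mem_span_singleton.1 hu
  have h1 := congrFun ((dotForm_self_eq_zero _).1 h0) (Classical.arbitrary ι)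
  rw [evalLin_apply, smul_eval, eval_C, Pi.zero_apply] at h1
  rw [smul_eq_C_mul, ← C_mul, h1, C_0]

section Output

variable {ε m : ℝ} {R : Output n}

theorem IsOutput.isSpanSplit (hR : IsOutput X ε m R) {t : ℕ} (h1 : 1 ≤ t) (hT : t ≤ R.T) :
    IsSpanSplit X ε (Submodule.span ℝ (candidates X R.F t : Set (Poly n))) (R.F t) (R.G t) :=
  (isSplit_iff X ε _ _ _).1 (hR.step t h1 hT)

theorem IsOutput.totalDegree_ne_zero (hR : IsOutput X ε m R) {t : ℕ} (h1 : 1 ≤ t) {p : Poly n}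
    (hp : p ∈ R.F t ∨ p ∈ R.G t) : p.totalDegree ≠ 0 := by
  rcases le_or_gt t R.T with hT | hT
  · exact (hR.isSpanSplit h1 hT).totalDegree_ne_zero hp
  · simp [hR.after t hT] at hp

/-- Each new `F_t` is evaluation-orthogonal to the earlier ones and has nonzero eigenvalues, so
definiteness passes to the sum. The base case, constants, needs a point. -/
theorem IsOutput.evalDefinite [Nonempty ι] (hε : 0 ≤ ε) (hR : IsOutput X ε m R) (t : ℕ) :
    EvalDefinite X (Submodule.span ℝ (upTo R.F t : Set (Poly n))) := by
  induction t with
  | zero =>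
    rw [span_upTo_zero, hR.F_zero, Finset.coe_singleton]
    exact evalDefinite_span_C m
  | succ t ih =>
    rw [span_upTo_succ]
    rcases le_or_gt (t + 1) R.T with hT | hT
    · have hs := hR.isSpanSplit (by omega) hT
      intro u hu h0
      obtain ⟨p, hp, q, hq, rfl⟩ := Submodule.mem_sup.1 hu
      have hpq : evalForm X p q = 0 :=
        candidates_orthogonal R.F (t + 1) hp (Submodule.span_le.2 hs.left_subset hq)
      have hqp : evalForm X q p = 0 := by rw [dotForm_comm, hpq]
      simp only [map_add, LinearMap.add_apply, hpq, hqp] at h0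
      have hp0 := dotForm_self_nonneg (evalLin X) p
      have hq0 := dotForm_self_nonneg (evalLin X) q
      rw [ih p hp (by linarith), hs.eq_zero_of_evalForm_self hε hq (by linarith), add_zero]
    · simpa [(hR.after _ hT).1] using ih

end Output

/-- Without points nothing is ever put into `F` or `G`. -/
theorem isSplit_iff_of_isEmpty [IsEmpty ι] {ε : ℝ} {H F G : Finset (Poly n)} :
    IsSplit X ε H F G ↔ F = ∅ ∧ G = ∅ := by
  rw [isSplit_iff]
  constructor
  · intro h
    have h1 : ∀ p : Poly n, gradForm X p p = 0 := fun p => by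
      simp [dotForm_apply]
    constructor <;> refine Finset.eq_empty_of_forall_notMem fun p hp => ?_
    · simpa [h1] using h.gradForm_self (.inl hp)
    · simpa [h1] using h.gradForm_self (.inr hp)
  · rintro ⟨rfl, rfl⟩
    have hs : Subsingleton (ι × Fin n → ℝ) := inferInstance
    refine ⟨0, Fin.elim0, Fin.elim0, ⟨?_, fun i => i.elim0, fun i => i.elim0, fun i => i.elim0⟩,
      by simp, by simp⟩
    exact (Module.finrank_zero_of_subsingleton).symm

end Projection

/-! ### Affine substitution in polynomials. -/

section Affine

variable {n : ℕ}

theorem totalDegree_aeval_le {σ τ R : Type*} [CommSemiring R] {f : σ → MvPolynomial τ R}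
    (hf : ∀ i, (f i).totalDegree ≤ 1) (p : MvPolynomial σ R) :
    (aeval f p).totalDegree ≤ p.totalDegree := by
  rw [aeval_def, eval₂_eq]
  refine totalDegree_finsetSum_le fun s hs => ?_
  refine (totalDegree_mul _ _).trans ?_
  rw [algebraMap_eq, totalDegree_C, zero_add]
  refine (totalDegree_finsetProd _ _).trans ?_
  refine le_trans ?_ (le_totalDegree hs)
  refine Finset.sum_le_sum fun i _ => ?_
  refine (totalDegree_pow _ _).trans ?_
  simpa using Nat.mul_le_mul_left (s i) (hf i)

/-- The substitution `h ↦ h(α⁻¹ x + β)`. -/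
def affineSubst (α : ℝ) (β : Fin n → ℝ) : Poly n →ₐ[ℝ] Poly n :=
  aeval fun i => (C α⁻¹ * MvPolynomial.X i + C (β i) : Poly n)

/-- The linear map `h ↦ α h(α⁻¹ x + β)`. -/
def affineLin (α : ℝ) (β : Fin n → ℝ) : Poly n →ₗ[ℝ] Poly n := α • (affineSubst α β).toLinearMap

theorem affineLin_apply (α : ℝ) (β : Fin n → ℝ) (h : Poly n) :
    affineLin α β h = α • affineSubst α β h := rfl

theorem eval_affineSubst {α : ℝ} (hα : α ≠ 0) (β x : Fin n → ℝ) (h : Poly n) :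
    eval (α • (x - β)) (affineSubst α β h) = eval x h := by
  induction h using MvPolynomial.induction_on with
  | C a => simp [affineSubst, algebraMap_eq]
  | add p q hp hq => simp only [map_add, hp, hq]
  | mul_X p i hp =>
    rw [map_mul, map_mul, hp, map_mul]
    simp [affineSubst, hα]

/-- The chain rule; the factor `α⁻¹` is what the prefactor `α` of `affineLin` cancels. -/
theorem pderiv_affineSubst (α : ℝ) (β : Fin n → ℝ) (k : Fin n) (h : Poly n) :
    pderiv k (affineSubst α β h) = α⁻¹ • affineSubst α β (pderiv k h) := by
  classical
  induction h using MvPolynomial.induction_on with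
  | C a => simp [affineSubst, algebraMap_eq]
  | add p q hp hq => simp only [map_add, hp, hq, smul_add]
  | mul_X p i hp =>
    have hX : affineSubst α β (MvPolynomial.X i : Poly n)
        = C α⁻¹ * MvPolynomial.X i + C (β i) := aeval_X _ _
    have hd : pderiv k (C α⁻¹ * MvPolynomial.X i + C (β i) : Poly n)
        = α⁻¹ • affineSubst α β (pderiv k (MvPolynomial.X i)) := by
      rw [map_add, pderiv_C_mul, pderiv_C, add_zero, pderiv_X, smul_eq_C_mul]
      by_cases hik : i = k
      · subst hik; simp
      · simp [Pi.single_eq_of_ne hik]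
    rw [map_mul, pderiv_mul, hp, hX, hd, pderiv_mul, map_add, map_mul, map_mul, hX, smul_add,
      smul_mul_assoc, mul_smul_comm]

/-- The inverse of `x ↦ α⁻¹x + β` is `x ↦ αx - αβ`, which has parameters `α⁻¹` and `-(α • β)`. -/
theorem affineSubst_affineSubst {α : ℝ} (hα : α ≠ 0) (β : Fin n → ℝ) (h : Poly n) :
    affineSubst α β (affineSubst α⁻¹ (-(α • β)) h) = h := by
  have : (affineSubst α β).comp (affineSubst α⁻¹ (-(α • β))) = AlgHom.id ℝ (Poly n) := by
    ext i : 1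
    simp only [affineSubst, AlgHom.comp_apply, aeval_X, map_add, map_mul, aeval_C, algebraMap_eq,
      AlgHom.id_apply, inv_inv, Pi.neg_apply, Pi.smul_apply, smul_eq_mul]
    rw [C_neg, C_mul]
    have hc : (C α * C α⁻¹ : Poly n) = 1 := by rw [← C_mul, mul_inv_cancel₀ hα, C_1]
    linear_combination (MvPolynomial.X i : Poly n) * hc
  exact DFunLike.congr_fun this h

theorem affineLin_affineLin {α : ℝ} (hα : α ≠ 0) (β : Fin n → ℝ) (h : Poly n) :
    affineLin α β (affineLin α⁻¹ (-(α • β)) h) = h := by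
  rw [affineLin_apply, affineLin_apply, map_smul, affineSubst_affineSubst hα, smul_smul,
    mul_inv_cancel₀ hα, one_smul]

theorem affineLin_affineLin' {α : ℝ} (hα : α ≠ 0) (β : Fin n → ℝ) (h : Poly n) :
    affineLin α⁻¹ (-(α • β)) (affineLin α β h) = h := by
  have := affineLin_affineLin (inv_ne_zero hα) (-(α • β)) h
  simpa [smul_smul, hα] using this

/-- Two prefactors `α` meet one. This is why products of transported polynomials match transported
products only up to scalars. -/
theorem affineLin_mul_affineLin {α : ℝ} (β : Fin n → ℝ) (p q : Poly n) :
    affineLin α β p * affineLin α β q = α • affineLin α β (p * q) := by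
  simp only [affineLin_apply, map_mul, smul_mul_smul_comm, smul_smul]

theorem affineLin_X {α : ℝ} (hα : α ≠ 0) (β : Fin n → ℝ) (i : Fin n) :
    affineLin α β (MvPolynomial.X i) = MvPolynomial.X i + C (α * β i) := by
  rw [affineLin_apply, affineSubst, aeval_X, smul_eq_C_mul, mul_add, ← mul_assoc, ← C_mul,
    mul_inv_cancel₀ hα, C_1, one_mul, ← C_mul]

theorem affineLin_C (α : ℝ) (β : Fin n → ℝ) (a : ℝ) :
    affineLin α β (C a) = C (α * a) := by
  rw [affineLin_apply, affineSubst, aeval_C, smul_eq_C_mul, algebraMap_eq, ← C_mul]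

theorem totalDegree_affineLin_le (α : ℝ) (β : Fin n → ℝ) (h : Poly n) :
    (affineLin α β h).totalDegree ≤ h.totalDegree := by
  refine (totalDegree_smul_le _ _).trans (totalDegree_aeval_le (fun i => ?_) h)
  refine (totalDegree_add _ _).trans (max_le ?_ (by simp))
  exact (totalDegree_mul _ _).trans (by simp)

theorem totalDegree_affineLin {α : ℝ} (hα : α ≠ 0) (β : Fin n → ℝ) (h : Poly n) :
    (affineLin α β h).totalDegree = h.totalDegree := by
  refine le_antisymm (totalDegree_affineLin_le α β h) ?_
  conv_lhs => rw [← affineLin_affineLin' hα β h]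
  exact totalDegree_affineLin_le _ _ _

/-- Every monomial of `p` has degree `τ` and so picks up exactly `a ^ τ`. -/
theorem aeval_C_mul_X_of_isHomogeneous {a : ℝ} {τ : ℕ} {p : Poly n} (hp : p.IsHomogeneous τ) :
    aeval (fun i => (C a * MvPolynomial.X i : Poly n)) p = a ^ τ • p := by
  conv_rhs => rw [p.as_sum, Finset.smul_sum]
  rw [aeval_def, eval₂_eq]
  refine Finset.sum_congr rfl fun s hs => ?_
  have hd : ∑ i ∈ s.support, s i = τ := by
    have := hp (mem_support_iff.1 hs)
    simpa [Finsupp.weight_apply, Finsupp.sum] using this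
  simp only [mul_pow, Finset.prod_mul_distrib, ← C_pow]
  rw [← map_prod, Finset.prod_pow_eq_pow_sum, hd, monomial_eq, smul_eq_C_mul, algebraMap_eq,
    Finsupp.prod]
  ring

theorem isDegreewiseIdentical_affineLin {α : ℝ} (hα : α ≠ 0) (h : Poly n) :
    IsDegreewiseIdentical 1 α (affineLin α 0 h) h := by
  rw [IsDegreewiseIdentical]
  conv_lhs => rw [← sum_homogeneousComponent h]
  rw [map_sum]
  refine Finset.sum_congr rfl fun τ _ => ?_
  rw [affineLin_apply, affineSubst]
  simp only [Pi.zero_apply, C_0, add_zero]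
  rw [aeval_C_mul_X_of_isHomogeneous (homogeneousComponent_isHomogeneous τ h), smul_smul,
    zpow_sub₀ hα, zpow_one, zpow_natCast, inv_pow, div_eq_mul_inv]

theorem isTranslate_affineLin (β : Fin n → ℝ) (h : Poly n) :
    IsTranslate β (affineLin 1 β h) h := by
  simp [IsTranslate, affineLin_apply, affineSubst]

end Affine

/-! ### Transported outputs, with the starting constant adjusted separately. -/

/-- Apply a map of polynomials to everything an output consists of. -/
def Output.map {n : ℕ} (f : Poly n → Poly n) (R : Output n) : Output n where
  T := R.T
  F t := open Classical in (R.F t).image f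
  G t := open Classical in (R.G t).image f

theorem span_image_linear {E E' : Type*} [AddCommGroup E] [Module ℝ E] [AddCommGroup E']
    [Module ℝ E'] [DecidableEq E'] (f : E →ₗ[ℝ] E') (S : Finset E) :
    Submodule.span ℝ (S.image f : Set E') = (Submodule.span ℝ (S : Set E)).map f := by
  rw [Submodule.map_span, Finset.coe_image]

/-- The map `h ↦ α h(α⁻¹ x + β)` on nonconstant polynomials, with another factor on constants. -/
def affineRescale {n : ℕ} (α : ℝ) (β : Fin n → ℝ) (c : ℝ) (h : Poly n) : Poly n :=
  if h.totalDegree = 0 then c • h else affineLin α β h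

section Rescale

variable {n : ℕ} {α : ℝ} (β : Fin n → ℝ) {c : ℝ}

theorem affineRescale_of_ne (α : ℝ) (c : ℝ) {h : Poly n} (hh : h.totalDegree ≠ 0) :
    affineRescale α β c h = affineLin α β h := if_neg hh

theorem totalDegree_affineRescale (hα : α ≠ 0) (c : ℝ) (h : Poly n) :
    (affineRescale α β c h).totalDegree = h.totalDegree := by
  rw [affineRescale]
  split_ifs with h0
  · exact le_antisymm (totalDegree_smul_le _ _) (by rw [h0]; exact Nat.zero_le _)
  · exact totalDegree_affineLin hα β h

/-- Total degree is preserved, so both applications fall into the same case. -/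
theorem affineRescale_affineRescale (hα : α ≠ 0) (hc : c ≠ 0) (h : Poly n) :
    affineRescale α β c (affineRescale α⁻¹ (-(α • β)) c⁻¹ h) = h := by
  by_cases h0 : h.totalDegree = 0
  · rw [affineRescale, totalDegree_affineRescale _ (inv_ne_zero hα), if_pos h0, affineRescale,
      if_pos h0, smul_smul, mul_inv_cancel₀ hc, one_smul]
  · rw [affineRescale, totalDegree_affineRescale _ (inv_ne_zero hα), if_neg h0, affineRescale,
      if_neg h0, affineLin_affineLin hα]

theorem affineRescale_injective (hα : α ≠ 0) (hc : c ≠ 0) :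
    Function.Injective (affineRescale α β c) := by
  have := affineRescale_affineRescale (-(α • β)) (inv_ne_zero hα) (inv_ne_zero hc)
  simp only [inv_inv, smul_neg, neg_neg, smul_smul, inv_mul_cancel₀ hα, one_smul] at this
  exact Function.LeftInverse.injective this

end Rescale

/-! ### Affine maps carry runs to runs. -/

section Transport

variable {n : ℕ} {ι : Type*} [Fintype ι] {X : ι → Fin n → ℝ} {α : ℝ} {β : Fin n → ℝ}

theorem evalLin_affineLin (hα : α ≠ 0) (p : Poly n) :
    evalLin (fun i => α • (X i - β)) (affineLin α β p) = α • evalLin X p := by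
  ext i
  rw [evalLin_apply, affineLin_apply, smul_eval, eval_affineSubst hα]
  rfl

theorem gradLin_affineLin (hα : α ≠ 0) (p : Poly n) :
    gradLin (fun i => α • (X i - β)) (affineLin α β p) = gradLin X p := by
  ext ⟨i, k⟩
  rw [gradLin_apply, gradLin_apply, affineLin_apply, Derivation.map_smul, pderiv_affineSubst,
    smul_smul, mul_inv_cancel₀ hα, one_smul, eval_affineSubst hα]

theorem evalForm_affineLin (hα : α ≠ 0) (p q : Poly n) :
    evalForm (fun i => α • (X i - β)) (affineLin α β p) (affineLin α β q)
      = α ^ 2 * evalForm X p q := by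
  rw [dotForm_apply, evalLin_affineLin hα, evalLin_affineLin hα, smul_dotProduct, dotProduct_smul,
    dotForm_apply, smul_eq_mul, smul_eq_mul]
  ring

theorem gradForm_affineLin (hα : α ≠ 0) (p q : Poly n) :
    gradForm (fun i => α • (X i - β)) (affineLin α β p) (affineLin α β q) = gradForm X p q := by
  rw [dotForm_apply, gradLin_affineLin hα, gradLin_affineLin hα, dotForm_apply]

/-- The same eigenvectors, transported, have eigenvalues `α² λ`; since `√(α² λ) = |α| √λ`, the
comparison with the threshold is unchanged. -/
theorem IsSpanSplit.affine (hα : α ≠ 0) {ε : ℝ} {U : Submodule ℝ (Poly n)} {F G : Finset (Poly n)}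
    (h : IsSpanSplit X ε U F G) :
    open Classical in
    IsSpanSplit (fun i => α • (X i - β)) (|α| * ε) (U.map (affineLin α β))
      (F.image (affineLin α β)) (G.image (affineLin α β)) := by
  classical
  obtain ⟨r, h, lam, H, rfl, rfl⟩ := h
  have hcomp : gradLin (fun i => α • (X i - β)) ∘ₗ affineLin α β = gradLin X :=
    LinearMap.ext fun p => gradLin_affineLin hα p
  have hs : ∀ i, √(α ^ 2 * lam i) = |α| * √(lam i) := fun i => by
    rw [Real.sqrt_mul (sq_nonneg α), Real.sqrt_sq_eq_abs]
  have hα' : 0 < |α| := abs_pos.2 hα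
  refine ⟨r, fun i => affineLin α β (h i), fun i => α ^ 2 * lam i, ⟨?_, ?_, ?_, ?_⟩, ?_, ?_⟩
  · rw [← Submodule.map_comp, hcomp, H.rank_eq]
  · exact fun i => Submodule.mem_map_of_mem (H.mem i)
  · rintro i _ ⟨c, hc, rfl⟩
    rw [evalForm_affineLin hα, gradForm_affineLin hα, H.eigen i c hc, mul_assoc]
  · intro i j
    rw [gradForm_affineLin hα, H.orthonormal]
  · simp only [hs, mul_lt_mul_iff_right₀ hα', Finset.image_image]
    rfl
  · simp only [hs, mul_le_mul_iff_right₀ hα', Finset.image_image]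
    rfl

theorem EvalDefinite.affine (hα : α ≠ 0) {U : Submodule ℝ (Poly n)} (hU : EvalDefinite X U) :
    EvalDefinite (fun i => α • (X i - β)) (U.map (affineLin α β)) := by
  rintro _ ⟨u, hu, rfl⟩ h0
  rw [evalForm_affineLin hα] at h0
  rw [hU u hu ((mul_eq_zero.1 h0).resolve_left (pow_ne_zero 2 hα)), map_zero]

/-- The slack allowed in `c'` absorbs the constants by which the map shifts the variables. -/
theorem orthProj_affine (hα : α ≠ 0) {H H' : Finset (Poly n)}
    (hd : EvalDefinite X (Submodule.span ℝ (H : Set (Poly n))))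
    (hH : Submodule.span ℝ (H' : Set (Poly n))
      = (Submodule.span ℝ (H : Set (Poly n))).map (affineLin α β))
    {c c' : Poly n} (hc : c' - affineLin α β c ∈ Submodule.span ℝ (H' : Set (Poly n))) :
    orthProj (fun i => α • (X i - β)) H' c' = affineLin α β (orthProj X H c) := by
  refine orthProj_eq_of_orthogonal (hH ▸ hd.affine hα) ?_ ?_
  · have h1 : affineLin α β (c - orthProj X H c) ∈ Submodule.span ℝ (H' : Set (Poly n)) :=
      hH ▸ Submodule.mem_map_of_mem (sub_orthProj_mem X H c)
    rw [map_sub] at h1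
    simpa using Submodule.add_mem _ hc h1
  · rw [hH]
    rintro _ ⟨u, hu, rfl⟩
    rw [evalForm_affineLin hα, evalForm_orthProj X H c hu, mul_zero]

theorem orthProj_smul {H : Finset (Poly n)}
    (hd : EvalDefinite X (Submodule.span ℝ (H : Set (Poly n)))) (a : ℝ) (c : Poly n) :
    orthProj X H (a • c) = a • orthProj X H c := by
  refine orthProj_eq_of_orthogonal hd ?_ fun u hu => ?_
  · rw [← smul_sub]
    exact Submodule.smul_mem _ _ (sub_orthProj_mem X H c)
  · rw [map_smul, evalForm_orthProj X H c hu, smul_zero]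

section Output

variable {ε m : ℝ} {R : Output n} {c : ℝ}

theorem IsOutput.image_affineRescale (hR : IsOutput X ε m R) {t : ℕ} (ht : 1 ≤ t) :
    open Classical in
    (R.F t).image (affineRescale α β c) = (R.F t).image (affineLin α β) ∧
    (R.G t).image (affineRescale α β c) = (R.G t).image (affineLin α β) := by
  classical
  exact ⟨Finset.image_congr fun p hp =>
      affineRescale_of_ne β α c (hR.totalDegree_ne_zero ht (.inl hp)),
    Finset.image_congr fun p hp =>
      affineRescale_of_ne β α c (hR.totalDegree_ne_zero ht (.inr hp))⟩

theorem IsOutput.span_upTo_map (hα : α ≠ 0) (hc : c ≠ 0) (hR : IsOutput X ε m R) (t : ℕ) :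
    Submodule.span ℝ (upTo (R.map (affineRescale α β c)).F t : Set (Poly n))
      = (Submodule.span ℝ (upTo R.F t : Set (Poly n))).map (affineLin α β) := by
  classical
  induction t with
  | zero =>
    rw [span_upTo_zero, span_upTo_zero]
    simp only [Output.map, hR.F_zero, Finset.image_singleton, Finset.coe_singleton,
      Submodule.map_span, Set.image_singleton]
    rw [affineRescale, if_pos (totalDegree_C m), affineLin_C, C_mul, ← smul_eq_C_mul,
      Submodule.span_singleton_smul_eq (IsUnit.mk0 _ hc),
      Submodule.span_singleton_smul_eq (IsUnit.mk0 _ hα)]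
  | succ t ih =>
    rw [span_upTo_succ, span_upTo_succ, ih, Submodule.map_sup]
    congr 1
    rw [← span_image_linear]
    simp only [Output.map]
    rw [(hR.image_affineRescale (by omega)).1]

theorem mem_candidates {F : ℕ → Finset (Poly n)} {t : ℕ} {d : Poly n} :
    d ∈ candidates X F t ↔ ∃ p ∈ preCandidates F t, orthProj X (upTo F (t - 1)) p = d := by
  rw [candidates, Finset.mem_image]

theorem IsOutput.C_mem_span_upTo (hm : m ≠ 0) (hR : IsOutput X ε m R) (a : ℝ) (t : ℕ) :
    C a ∈ Submodule.span ℝ (upTo R.F t : Set (Poly n)) := by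
  have h1 : (C m : Poly n) ∈ Submodule.span ℝ (upTo R.F t : Set (Poly n)) := by
    refine Submodule.subset_span ?_
    rw [Finset.mem_coe, upTo, Finset.mem_biUnion]
    exact ⟨0, by simp, by simp [hR.F_zero]⟩
  have h2 := Submodule.smul_mem _ (a / m) h1
  rwa [smul_eq_C_mul, ← C_mul, div_mul_cancel₀ _ hm] at h2

/-- At step 1 the shift of each variable is a constant, hence projected away. Later candidates are
transported up to the factor `α`, so only the spans agree, not the sets. -/
theorem IsOutput.span_candidates_map [Nonempty ι] (hε : 0 ≤ ε) (hα : α ≠ 0) (hm : m ≠ 0)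
    (hc : c ≠ 0) (hR : IsOutput X ε m R) {t : ℕ} (ht : 1 ≤ t) :
    Submodule.span ℝ (candidates (fun i => α • (X i - β)) (R.map (affineRescale α β c)).F t :
        Set (Poly n))
      = (Submodule.span ℝ (candidates X R.F t : Set (Poly n))).map (affineLin α β) := by
  classical
  have hd := hR.evalDefinite hε (t - 1)
  have hH := hR.span_upTo_map (β := β) hα hc (t - 1)
  set F' := (R.map (affineRescale α β c)).F
  obtain _ | _ | t := t
  · omega
  · rw [← span_image_linear]
    congr 2
    rw [candidates, candidates, Finset.image_image]
    refine Finset.image_congr fun p hp => ?_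
    obtain ⟨i, _, rfl⟩ := Finset.mem_image.1 (Finset.mem_coe.1 hp)
    refine orthProj_affine hα hd hH ?_
    rw [affineLin_X hα, sub_add_cancel_left, ← C_neg, hH]
    -- The map sends the constant `-βᵢ` to the discrepancy `-αβᵢ`.
    refine ⟨C (-β i), hR.C_mem_span_upTo hm _ _, ?_⟩
    rw [affineLin_C, mul_neg]
  · have key : ∀ p q : Poly n, orthProj (fun i => α • (X i - β)) (upTo F' (t + 1))
        (affineLin α β p * affineLin α β q)
        = α • affineLin α β (orthProj X (upTo R.F (t + 1)) (p * q)) := by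
      intro p q
      rw [Nat.add_sub_cancel] at hd hH
      rw [← map_smul, ← orthProj_smul hd]
      refine orthProj_affine hα hd hH ?_
      rw [affineLin_mul_affineLin, map_smul, sub_self]
      exact Submodule.zero_mem _
    have hF1 : ∀ s, F' (s + 1) = (R.F (s + 1)).image (affineLin α β) :=
      fun s => (hR.image_affineRescale (by omega)).1
    apply le_antisymm
    · refine Submodule.span_le.2 fun d hd' => ?_
      obtain ⟨_, hpre, rfl⟩ := mem_candidates.1 hd'
      obtain ⟨p', hp', q', hq', rfl⟩ := Finset.mem_image₂.1 hpre
      obtain ⟨p, hp, rfl⟩ := Finset.mem_image.1 (hF1 0 ▸ hp')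
      obtain ⟨q, hq, rfl⟩ := Finset.mem_image.1 (hF1 t ▸ hq')
      rw [SetLike.mem_coe, Nat.add_sub_cancel, key]
      refine Submodule.smul_mem _ _ (Submodule.mem_map_of_mem (Submodule.subset_span ?_))
      exact mem_candidates.2 ⟨_, Finset.mem_image₂_of_mem hp hq, rfl⟩
    · rw [Submodule.map_span_le]
      intro d hd'
      obtain ⟨_, hpre, rfl⟩ := mem_candidates.1 hd'
      obtain ⟨p, hp, q, hq, rfl⟩ := Finset.mem_image₂.1 hpre
      rw [Nat.add_sub_cancel, ← inv_smul_smul₀ hα (affineLin α β _), ← key]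
      refine Submodule.smul_mem _ _ (Submodule.subset_span ?_)
      refine mem_candidates.2 ⟨_, Finset.mem_image₂_of_mem ?_ ?_, rfl⟩
      · rw [hF1 0]; exact Finset.mem_image_of_mem _ hp
      · rw [hF1 t]; exact Finset.mem_image_of_mem _ hq

/-- Affine maps of the points transport outputs to outputs. -/
theorem IsOutput.map_affineRescale (hε : 0 ≤ ε) (hα : α ≠ 0) {m' : ℝ} (hm : m ≠ 0) (hm' : m' ≠ 0)
    (hR : IsOutput X ε m R) :
    IsOutput (fun i => α • (X i - β)) (|α| * ε) m' (R.map (affineRescale α β (m' / m))) := by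
  classical
  have hc : m' / m ≠ 0 := div_ne_zero hm' hm
  constructor
  · simp only [Output.map, hR.F_zero, Finset.image_singleton]
    rw [affineRescale, if_pos (totalDegree_C m), smul_eq_C_mul, ← C_mul, div_mul_cancel₀ _ hm]
  · simp [Output.map, hR.G_zero]
  · exact hR.one_le
  · intro t h1 hT
    -- Without points definiteness on constants fails, but every `F_t` and `G_t` built is empty.
    cases isEmpty_or_nonempty ι
    · have h2 := isSplit_iff_of_isEmpty.1 (hR.step t h1 hT)
      refine isSplit_iff_of_isEmpty.2 ?_
      simp [Output.map, h2.1, h2.2]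
    · rw [isSplit_iff, hR.span_candidates_map hε hα hm hc h1]
      simp only [Output.map]
      rw [(hR.image_affineRescale h1).1, (hR.image_affineRescale h1).2]
      exact (hR.isSpanSplit h1 hT).affine hα
  · intro t h1 hT
    simpa [Output.map] using hR.continues t h1 hT
  · simp [Output.map, hR.stops]
  · intro t hT
    simp [Output.map, hR.after t hT]

end Output

end Transport

/-! ### Matching outputs in both directions. -/

section Correspondence

variable {n : ℕ}

theorem upTo_map (f : Poly n → Poly n) (F : ℕ → Finset (Poly n)) (t : ℕ) :
    open Classical in upTo (fun s => (F s).image f) t = (upTo F t).image f := by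
  classical
  simp only [upTo]
  rw [Finset.biUnion_image]

theorem card_filter_totalDegree_image [DecidableEq (Poly n)] {f : Poly n → Poly n}
    (hf : Function.Injective f)
    (hdeg : ∀ h, (f h).totalDegree = h.totalDegree) (S : Finset (Poly n)) (d : ℕ) :
    ((S.image f).filter fun h => h.totalDegree = d).card
      = (S.filter fun h => h.totalDegree = d).card := by
  rw [Finset.filter_image, Finset.card_image_of_injective _ hf]
  simp only [hdeg]

theorem exists_equiv_image [DecidableEq (Poly n)] {f : Poly n → Poly n}
    (hf : Function.Injective f) {rel : Poly n → Poly n → Prop} (hrel : ∀ h, rel (f h) h)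
    (S : Finset (Poly n)) : ∃ e : S ≃ S.image f, ∀ h : S, rel (e h : Poly n) (h : Poly n) := by
  refine ⟨Equiv.ofBijective (fun h => ⟨f h, Finset.mem_image_of_mem f h.2⟩) ⟨?_, ?_⟩,
    fun h => hrel h⟩
  · exact fun a b hab => Subtype.ext (hf (congrArg Subtype.val hab))
  · rintro ⟨q, hq⟩
    obtain ⟨p, hp, rfl⟩ := Finset.mem_image.1 hq
    exact ⟨⟨p, hp⟩, rfl⟩

theorem corresponds_map {f : Poly n → Poly n} (hf : Function.Injective f)
    (hdeg : ∀ h, (f h).totalDegree = h.totalDegree) {rel : Poly n → Poly n → Prop}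
    (hrel : ∀ h, rel (f h) h) (R : Output n) : Corresponds rel R (R.map f) := by
  classical
  refine ⟨rfl, fun t => exists_equiv_image hf hrel _, fun t => exists_equiv_image hf hrel _,
    ⟨fun d => ?_, fun d => ?_⟩⟩
  · have : (R.map f).allF = R.allF.image f := upTo_map f R.F R.T
    rw [this, card_filter_totalDegree_image hf hdeg]
  · have : (R.map f).allG = R.allG.image f := upTo_map f R.G R.T
    rw [this, card_filter_totalDegree_image hf hdeg]

theorem Corresponds.sameStepCounts {rel : Poly n → Poly n → Prop} {R R' : Output n}
    (h : Corresponds rel R R') : SameStepCounts R R' := by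
  refine ⟨h.T_eq, fun t => ?_, fun t => ?_⟩
  · obtain ⟨e, -⟩ := h.matchF t
    simpa using (Fintype.card_congr e).symm
  · obtain ⟨e, -⟩ := h.matchG t
    simpa using (Fintype.card_congr e).symm

theorem Output.map_map_eq_self {f g : Poly n → Poly n} (h : ∀ p, f (g p) = p) (R : Output n) :
    (R.map g).map f = R := by
  have hfg : f ∘ g = id := funext h
  cases R
  simp [Output.map, Finset.image_image, hfg]

variable {ι : Type*} [Fintype ι] {X : ι → Fin n → ℝ} {ε : ℝ} {α : ℝ} {β : Fin n → ℝ} {m m' : ℝ}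
  {rel : Poly n → Poly n → Prop}

theorem exists_corresponds_affine (hε : 0 ≤ ε) (hα : α ≠ 0) (hm : m ≠ 0) (hm' : m' ≠ 0)
    (hrel : ∀ h, rel (affineRescale α β (m' / m) h) h) {R : Output n} (hR : IsOutput X ε m R) :
    ∃ R', IsOutput (fun i => α • (X i - β)) (|α| * ε) m' R' ∧ Corresponds rel R R' :=
  ⟨_, hR.map_affineRescale hε hα hm hm',
    corresponds_map (affineRescale_injective β hα (div_ne_zero hm' hm))
      (totalDegree_affineRescale β hα _) hrel R⟩

/-- The inverse affine map restores the points and the threshold; mapping the resulting output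
forward gives back `R'`. -/
theorem exists_corresponds_affine_symm (hε : 0 ≤ ε) (hα : α ≠ 0) (hm : m ≠ 0) (hm' : m' ≠ 0)
    (hrel : ∀ h, rel (affineRescale α β (m' / m) h) h) {R' : Output n}
    (hR' : IsOutput (fun i => α • (X i - β)) (|α| * ε) m' R') :
    ∃ R, IsOutput X ε m R ∧ Corresponds rel R R' := by
  have h1 := hR'.map_affineRescale (β := -(α • β)) (mul_nonneg (abs_nonneg α) hε)
    (inv_ne_zero hα) hm' hm
  have hX : (fun i => α⁻¹ • (α • (X i - β) - -(α • β))) = X := by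
    funext i
    rw [sub_neg_eq_add, ← smul_add, sub_add_cancel, inv_smul_smul₀ hα]
  have hε' : |α⁻¹| * (|α| * ε) = ε := by
    rw [abs_inv, inv_mul_cancel_left₀ (abs_ne_zero.2 hα)]
  rw [hX, hε', ← inv_div] at h1
  refine ⟨_, h1, ?_⟩
  have h2 := corresponds_map (affineRescale_injective β hα (div_ne_zero hm' hm))
      (totalDegree_affineRescale β hα _) hrel
      (R'.map (affineRescale α⁻¹ (-(α • β)) (m' / m)⁻¹))
  rwa [Output.map_map_eq_self (affineRescale_affineRescale β hα (div_ne_zero hm' hm))] at h2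

end Correspondence


/-! ### Independence of the choice of eigenvectors. -/

section Uniqueness

variable {n : ℕ} {ι : Type*} [Fintype ι] (X : ι → Fin n → ℝ)

/-- The polynomials that vanish on `X` together with their gradients. -/
def doubleVanishing : Submodule ℝ (Poly n) := (evalLin X).ker ⊓ (gradLin X).ker

variable {X}

theorem mem_doubleVanishing {p : Poly n} :
    p ∈ doubleVanishing X ↔ evalLin X p = 0 ∧ gradLin X p = 0 := by
  rw [doubleVanishing, Submodule.mem_inf, LinearMap.mem_ker, LinearMap.mem_ker]

/-- By the product rule. It makes products of congruent factors congruent, which carries the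
comparison to the next step. -/
theorem mul_mem_doubleVanishing {p : Poly n} (hp : p ∈ doubleVanishing X) (q : Poly n) :
    q * p ∈ doubleVanishing X := by
  rw [mem_doubleVanishing] at hp ⊢
  have h1 : ∀ i, eval (X i) p = 0 := congrFun hp.1
  have h2 : ∀ i k, eval (X i) (pderiv k p) = 0 := fun i k => congrFun hp.2 (i, k)
  constructor
  · ext i
    simp [evalLin_apply, h1]
  · ext ⟨i, k⟩
    simp [gradLin_apply, h1, h2]

theorem evalForm_eq_zero_of_mem {p : Poly n} (hp : p ∈ doubleVanishing X) (q : Poly n) :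
    evalForm X q p = 0 :=
  dotForm_eq_zero_of_right _ (mem_doubleVanishing.1 hp).1 q

theorem gradForm_eq_zero_of_mem {p : Poly n} (hp : p ∈ doubleVanishing X) (q : Poly n) :
    gradForm X q p = 0 :=
  dotForm_eq_zero_of_right _ (mem_doubleVanishing.1 hp).2 q

theorem map_gradLin_sup_doubleVanishing (U : Submodule ℝ (Poly n)) :
    (U ⊔ doubleVanishing X).map (gradLin X) = U.map (gradLin X) := by
  rw [Submodule.map_sup, sup_eq_left]
  rintro _ ⟨p, hp, rfl⟩
  rw [(mem_doubleVanishing.1 hp).2]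
  exact Submodule.zero_mem _

section Split

variable {ε : ℝ} {U U' : Submodule ℝ (Poly n)} {F G F' G' : Finset (Poly n)}

/-- An element of an eigenspace is a combination of the eigenvectors with the same eigenvalue,
up to a polynomial that vanishes to second order. -/
theorem IsEigensystem.sub_sum_mem {r : ℕ} {h : Fin r → Poly n} {lam : Fin r → ℝ}
    (H : IsEigensystem X U h lam) {u : Poly n} (hu : u ∈ U) {μ : ℝ}
    (he : ∀ c ∈ U, evalForm X c u = μ * gradForm X c u) :
    u - ∑ i, gradForm X (h i) u • h i ∈ doubleVanishing X ∧
      ∀ i, lam i ≠ μ → gradForm X (h i) u = 0 := by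
  have hne : ∀ i, lam i ≠ μ → gradForm X (h i) u = 0 := by
    intro i hi
    have h1 := he _ (H.mem i)
    -- Symmetry evaluates one pairing with either eigenvalue, so distinct eigenvalues force
    -- gradient-orthogonality.
    rw [dotForm_comm, H.eigen i u hu, dotForm_comm (gradLin X) u] at h1
    have h2 : (lam i - μ) * gradForm X (h i) u = 0 := by linear_combination h1
    exact (mul_eq_zero.1 h2).resolve_left (sub_ne_zero.2 hi)
  refine ⟨?_, hne⟩
  set w := u - ∑ i, gradForm X (h i) u • h i with hw
  have hwU : w ∈ U :=
    Submodule.sub_mem _ hu (Submodule.sum_mem _ fun i _ => Submodule.smul_mem _ _ (H.mem i))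
  have hg : gradLin X w = 0 := by
    refine eq_zero_of_dotForm_orthonormal _ H.rank_eq H.mem H.orthonormal hwU fun i => ?_
    have ho := H.orthonormal i
    simp only [hw, map_sub, map_sum, map_smul, ho]
    simp
  refine mem_doubleVanishing.2 ⟨(dotForm_self_eq_zero _).1 ?_, hg⟩
  -- Only terms with eigenvalue `μ` survive in `w`, so its evaluation norm vanishes along with its
  -- gradient norm.
  have h1 : evalForm X w w = μ * gradForm X w w := by
    rw [hw, map_sub (evalForm X _), map_sub (gradForm X _), mul_sub, ← hw, he w hwU]
    simp only [map_sum, map_smul, Finset.mul_sum]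
    congr 1
    refine Finset.sum_congr rfl fun i _ => ?_
    by_cases hi : lam i = μ
    · rw [H.eigen i w hwU, hi]
      simp only [smul_eq_mul]; ring
    · simp [hne i hi]
  rw [h1, dotForm_eq_zero_of_left _ hg, mul_zero]

/-- Modulo `J` an eigenvector in `F` has a representative in `U'` satisfying the same eigenvector
identity. It is a combination of those `h'` with that same eigenvalue, which therefore also pass the
threshold. -/
theorem IsSpanSplit.span_le (hU : U ⊔ doubleVanishing X = U' ⊔ doubleVanishing X)
    (h : IsSpanSplit X ε U F G) (h' : IsSpanSplit X ε U' F' G') :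
    Submodule.span ℝ (F : Set (Poly n))
      ≤ Submodule.span ℝ (F' : Set (Poly n)) ⊔ doubleVanishing X := by
  classical
  obtain ⟨r, h, lam, H, rfl, rfl⟩ := h
  obtain ⟨r', h', lam', H', rfl, rfl⟩ := h'
  refine Submodule.span_le.2 fun p hp => ?_
  obtain ⟨i, hi, rfl⟩ := Finset.mem_image.1 (Finset.mem_coe.1 hp)
  have hi' := (Finset.mem_filter.1 hi).2
  have hmem : h i ∈ U' ⊔ doubleVanishing X := hU ▸ Submodule.mem_sup_left (H.mem i)
  obtain ⟨u, hu, j, hj, huj⟩ := Submodule.mem_sup.1 hmem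
  have he : ∀ c ∈ U', evalForm X c u = lam i * gradForm X c u := by
    intro c hc
    have hc' : c ∈ U ⊔ doubleVanishing X := hU ▸ Submodule.mem_sup_left hc
    obtain ⟨d, hd, k, hk, rfl⟩ := Submodule.mem_sup.1 hc'
    have h1 := H.eigen i d hd
    rw [← huj] at h1
    simp only [map_add, LinearMap.add_apply, evalForm_eq_zero_of_mem hj,
      gradForm_eq_zero_of_mem hj, add_zero] at h1 ⊢
    rw [h1, dotForm_comm _ k, dotForm_comm _ k, evalForm_eq_zero_of_mem hk,
      gradForm_eq_zero_of_mem hk, add_zero, add_zero]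
  obtain ⟨h1, h2⟩ := H'.sub_sum_mem hu he
  have h3 : ∑ k, gradForm X (h' k) u • h' k ∈ Submodule.span ℝ
      (((Finset.univ.filter fun k => ε < √(lam' k)).image h' : Finset (Poly n)) :
        Set (Poly n)) := by
    refine Submodule.sum_mem _ fun k _ => ?_
    by_cases hk : lam' k = lam i
    · refine Submodule.smul_mem _ _ (Submodule.subset_span ?_)
      exact Finset.mem_coe.2 (Finset.mem_image_of_mem _ (by simpa [hk] using hi'))
    · rw [h2 k hk, zero_smul]
      exact Submodule.zero_mem _
  rw [SetLike.mem_coe, ← huj]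
  exact Submodule.mem_sup.2 ⟨_, h3, _, Submodule.add_mem _ h1 hj, by abel⟩

theorem IsSpanSplit.span_sup_eq (hU : U ⊔ doubleVanishing X = U' ⊔ doubleVanishing X)
    (h : IsSpanSplit X ε U F G) (h' : IsSpanSplit X ε U' F' G') :
    Submodule.span ℝ (F : Set (Poly n)) ⊔ doubleVanishing X
      = Submodule.span ℝ (F' : Set (Poly n)) ⊔ doubleVanishing X :=
  le_antisymm (sup_le (h.span_le hU h') le_sup_right) (sup_le (h'.span_le hU.symm h) le_sup_right)

/-- `F` and `F ∪ G` are counted by gradient ranks, which ignore `J`; `G` follows by subtraction. -/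
theorem IsSpanSplit.card_eq (hU : U ⊔ doubleVanishing X = U' ⊔ doubleVanishing X)
    (h : IsSpanSplit X ε U F G) (h' : IsSpanSplit X ε U' F' G') :
    F'.card = F.card ∧ G'.card = G.card := by
  have h1 : F'.card = F.card := by
    rw [h.card_left, h'.card_left, ← map_gradLin_sup_doubleVanishing, ← h.span_sup_eq hU h',
      map_gradLin_sup_doubleVanishing]
  have h2 : F'.card + G'.card = F.card + G.card := by
    rw [h.card_add_card, h'.card_add_card, ← map_gradLin_sup_doubleVanishing, ← hU,
      map_gradLin_sup_doubleVanishing]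
  exact ⟨h1, by omega⟩

end Split

section Projection

variable {H H' : Finset (Poly n)}

theorem orthProj_add (hd : EvalDefinite X (Submodule.span ℝ (H : Set (Poly n)))) (b c : Poly n) :
    orthProj X H (b + c) = orthProj X H b + orthProj X H c := by
  refine orthProj_eq_of_orthogonal hd ?_ fun u hu => ?_
  · rw [add_sub_add_comm]
    exact Submodule.add_mem _ (sub_orthProj_mem X H b) (sub_orthProj_mem X H c)
  · rw [map_add, evalForm_orthProj X H b hu, evalForm_orthProj X H c hu, add_zero]

theorem orthProj_congr (hd : EvalDefinite X (Submodule.span ℝ (H : Set (Poly n))))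
    (hH : Submodule.span ℝ (H : Set (Poly n)) ⊔ doubleVanishing X
      = Submodule.span ℝ (H' : Set (Poly n)) ⊔ doubleVanishing X)
    {c c' : Poly n} (hc : c - c' ∈ doubleVanishing X) :
    orthProj X H c - orthProj X H' c' ∈ doubleVanishing X := by
  have hmem : c' - orthProj X H' c' ∈ Submodule.span ℝ (H : Set (Poly n)) ⊔ doubleVanishing X :=
    hH ▸ Submodule.mem_sup_left (sub_orthProj_mem X H' c')
  obtain ⟨u, hu, j, hj, huj⟩ := Submodule.mem_sup.1 hmem
  have hw : u - (c - orthProj X H c) ∈ Submodule.span ℝ (H : Set (Poly n)) :=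
    Submodule.sub_mem _ hu (sub_orthProj_mem X H c)
  set w := u - (c - orthProj X H c) with hwdef
  have hdiff : orthProj X H c - orthProj X H' c' = w + (c - c' + j) := by
    rw [hwdef]
    linear_combination -huj
  have hj' : c - c' + j ∈ doubleVanishing X := Submodule.add_mem _ hc hj
  have hw' : w ∈ Submodule.span ℝ (H' : Set (Poly n)) ⊔ doubleVanishing X :=
    hH ▸ Submodule.mem_sup_left hw
  obtain ⟨v, hv, k, hk, hvk⟩ := Submodule.mem_sup.1 hw'
  -- `w` lies in the span of `H` and, modulo `J`, in that of `H'`, so it is orthogonal to both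
  -- residuals; their difference is `w` modulo `J`.
  have h1 : evalForm X w (orthProj X H c - orthProj X H' c') = 0 := by
    rw [map_sub, evalForm_orthProj X H c hw, ← hvk, map_add, LinearMap.add_apply,
      evalForm_orthProj X H' c' hv, dotForm_comm, evalForm_eq_zero_of_mem hk, add_zero, sub_zero]
  rw [hdiff, map_add, evalForm_eq_zero_of_mem hj', add_zero] at h1
  rw [hdiff, hd w hw h1, zero_add]
  exact hj'

theorem orthProj_mem_span_candidates {F : ℕ → Finset (Poly n)} {t : ℕ}
    (hd : EvalDefinite X (Submodule.span ℝ (upTo F (t - 1) : Set (Poly n)))) {c : Poly n}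
    (hc : c ∈ Submodule.span ℝ (preCandidates F t : Set (Poly n))) :
    orthProj X (upTo F (t - 1)) c ∈ Submodule.span ℝ (candidates X F t : Set (Poly n)) := by
  induction hc using Submodule.span_induction with
  | mem c hc => exact Submodule.subset_span (mem_candidates.2 ⟨c, hc, rfl⟩)
  | zero =>
    -- The scalar `0` yields that the projection of zero is zero.
    have := orthProj_smul hd 0 0
    rw [zero_smul, zero_smul] at this
    rw [this]
    exact Submodule.zero_mem _
  | add x y _ _ hx hy =>
    rw [orthProj_add hd]
    exact Submodule.add_mem _ hx hy
  | smul a x _ hx =>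
    rw [orthProj_smul hd]
    exact Submodule.smul_mem _ _ hx

end Projection

theorem span_upTo_sup_eq {F F' : ℕ → Finset (Poly n)} {t : ℕ}
    (h : ∀ s ≤ t, Submodule.span ℝ (F s : Set (Poly n)) ⊔ doubleVanishing X
      = Submodule.span ℝ (F' s : Set (Poly n)) ⊔ doubleVanishing X) :
    Submodule.span ℝ (upTo F t : Set (Poly n)) ⊔ doubleVanishing X
      = Submodule.span ℝ (upTo F' t : Set (Poly n)) ⊔ doubleVanishing X := by
  induction t with
  | zero => simpa only [span_upTo_zero] using h 0 le_rfl
  | succ t ih =>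
    rw [span_upTo_succ, span_upTo_succ, sup_sup_distrib_right, h (t + 1) le_rfl,
      ih fun s hs => h s (by omega), ← sup_sup_distrib_right]

theorem span_preCandidates_le {F F' : ℕ → Finset (Poly n)} {t : ℕ}
    (h : ∀ s < t, Submodule.span ℝ (F s : Set (Poly n)) ⊔ doubleVanishing X
      = Submodule.span ℝ (F' s : Set (Poly n)) ⊔ doubleVanishing X) :
    Submodule.span ℝ (preCandidates F t : Set (Poly n))
      ≤ Submodule.span ℝ (preCandidates F' t : Set (Poly n)) ⊔ doubleVanishing X := by
  classical
  obtain _ | _ | t := t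
  · exact le_sup_left
  · exact le_sup_left
  · refine Submodule.span_le.2 fun c hc => ?_
    obtain ⟨p, hp, q, hq, rfl⟩ := Finset.mem_image₂.1 (Finset.mem_coe.1 hc)
    have hp' : p ∈ Submodule.span ℝ (F' 1 : Set (Poly n)) ⊔ doubleVanishing X :=
      h 1 (by omega) ▸ Submodule.mem_sup_left (Submodule.subset_span hp)
    have hq' : q ∈ Submodule.span ℝ (F' (t + 1) : Set (Poly n)) ⊔ doubleVanishing X :=
      h (t + 1) (by omega) ▸ Submodule.mem_sup_left (Submodule.subset_span hq)
    obtain ⟨a, ha, j, hj, rfl⟩ := Submodule.mem_sup.1 hp'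
    obtain ⟨b, hb, k, hk, rfl⟩ := Submodule.mem_sup.1 hq'
    have hab : a * b ∈ Submodule.span ℝ (preCandidates F' (t + 2) : Set (Poly n)) := by
      have := Submodule.mul_mem_mul ha hb
      rw [Submodule.span_mul_span] at this
      rwa [preCandidates, Finset.coe_image₂]
    -- `(a + j)(b + k) = ab + (a + j)k + bj`, with the last two terms in `J`.
    refine Submodule.mem_sup.2 ⟨_, hab, (a + j) * k + b * j, ?_, by ring⟩
    exact Submodule.add_mem _ (mul_mem_doubleVanishing hk _) (mul_mem_doubleVanishing hj _)

section Output

variable {ε m : ℝ} {R R' : Output n}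

theorem IsOutput.span_candidates_le [Nonempty ι] (hε : 0 ≤ ε) (hR : IsOutput X ε m R)
    (hR' : IsOutput X ε m R') {t : ℕ} (ht : 1 ≤ t)
    (h : ∀ s < t, Submodule.span ℝ (R.F s : Set (Poly n)) ⊔ doubleVanishing X
      = Submodule.span ℝ (R'.F s : Set (Poly n)) ⊔ doubleVanishing X) :
    Submodule.span ℝ (candidates X R.F t : Set (Poly n))
      ≤ Submodule.span ℝ (candidates X R'.F t : Set (Poly n)) ⊔ doubleVanishing X := by
  refine Submodule.span_le.2 fun d hd => ?_
  obtain ⟨c, hc, rfl⟩ := mem_candidates.1 (Finset.mem_coe.1 hd)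
  obtain ⟨c', hc', j, hj, rfl⟩ :=
    Submodule.mem_sup.1 (span_preCandidates_le h (Submodule.subset_span hc))
  have h1 := orthProj_congr (c := c' + j) (c' := c') (hR.evalDefinite hε (t - 1))
    (span_upTo_sup_eq fun s hs => h s (by omega)) (by rwa [add_sub_cancel_left])
  have h2 := orthProj_mem_span_candidates (hR'.evalDefinite hε (t - 1)) hc'
  exact Submodule.mem_sup.2 ⟨_, h2, _, h1, add_sub_cancel _ _⟩

theorem IsOutput.span_candidates_sup_eq [Nonempty ι] (hε : 0 ≤ ε) (hR : IsOutput X ε m R)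
    (hR' : IsOutput X ε m R') {t : ℕ} (ht : 1 ≤ t)
    (h : ∀ s < t, Submodule.span ℝ (R.F s : Set (Poly n)) ⊔ doubleVanishing X
      = Submodule.span ℝ (R'.F s : Set (Poly n)) ⊔ doubleVanishing X) :
    Submodule.span ℝ (candidates X R.F t : Set (Poly n)) ⊔ doubleVanishing X
      = Submodule.span ℝ (candidates X R'.F t : Set (Poly n)) ⊔ doubleVanishing X :=
  le_antisymm (sup_le (hR.span_candidates_le hε hR' ht h) le_sup_right)
    (sup_le (hR'.span_candidates_le hε hR ht fun s hs => (h s hs).symm) le_sup_right)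

theorem IsOutput.span_F_sup_eq [Nonempty ι] (hε : 0 ≤ ε) (hR : IsOutput X ε m R)
    (hR' : IsOutput X ε m R') {t : ℕ} (hT : t ≤ R.T) (hT' : t ≤ R'.T) :
    Submodule.span ℝ (R.F t : Set (Poly n)) ⊔ doubleVanishing X
      = Submodule.span ℝ (R'.F t : Set (Poly n)) ⊔ doubleVanishing X := by
  induction t using Nat.strong_induction_on with
  | _ t ih =>
    obtain _ | t := t
    · rw [hR.F_zero, hR'.F_zero]
    · exact (hR.isSpanSplit (by omega) hT).span_sup_eq
        (hR.span_candidates_sup_eq hε hR' (by omega)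
          fun s hs => ih s hs (by omega) (by omega))
        (hR'.isSpanSplit (by omega) hT')

theorem IsOutput.card_eq (hε : 0 ≤ ε) (hR : IsOutput X ε m R)
    (hR' : IsOutput X ε m R') {t : ℕ} (hT : t ≤ R.T) (hT' : t ≤ R'.T) :
    (R'.F t).card = (R.F t).card ∧ (R'.G t).card = (R.G t).card := by
  obtain _ | t := t
  · rw [hR.F_zero, hR'.F_zero, hR.G_zero, hR'.G_zero]
    simp
  · cases isEmpty_or_nonempty ι
    · have h1 := isSplit_iff_of_isEmpty.1 (hR.step (t + 1) (by omega) hT)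
      have h2 := isSplit_iff_of_isEmpty.1 (hR'.step (t + 1) (by omega) hT')
      simp [h1, h2]
    · exact (hR.isSpanSplit (by omega) hT).card_eq
        (hR.span_candidates_sup_eq hε hR' (by omega)
          fun s hs => hR.span_F_sup_eq hε hR' (by omega) (by omega))
        (hR'.isSpanSplit (by omega) hT')

/-- A longer run `R'` would have to continue at step `R.T`, where equal counts make its `F` empty.
-/
theorem IsOutput.T_le (hε : 0 ≤ ε) (hR : IsOutput X ε m R) (hR' : IsOutput X ε m R') :
    R'.T ≤ R.T := by
  by_contra! hlt
  have h1 := (hR.card_eq hε hR' le_rfl hlt.le).1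
  rw [hR.stops, Finset.card_empty, Finset.card_eq_zero] at h1
  exact hR'.continues _ hR.one_le hlt h1

theorem IsOutput.sameStepCounts (hε : 0 ≤ ε) (hR : IsOutput X ε m R) (hR' : IsOutput X ε m R') :
    SameStepCounts R R' := by
  have hT : R'.T = R.T := le_antisymm (hR.T_le hε hR') (hR'.T_le hε hR)
  have key : ∀ t, (R'.F t).card = (R.F t).card ∧ (R'.G t).card = (R.G t).card := by
    intro t
    rcases le_or_gt t R.T with h | h
    · exact hR.card_eq hε hR' h (hT ▸ h)
    · simp [hR.after t h, hR'.after t (hT ▸ h)]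
  exact ⟨hT, fun t => (key t).1, fun t => (key t).2⟩

end Output

end Uniqueness

theorem SameStepCounts.trans {n : ℕ} {R R' R'' : Output n} (h : SameStepCounts R R')
    (h' : SameStepCounts R' R'') : SameStepCounts R R'' :=
  ⟨h'.T_eq.trans h.T_eq, fun t => (h'.card_F t).trans (h.card_F t),
    fun t => (h'.card_G t).trans (h.card_G t)⟩

/-- Equal starting constants give the factor 1 on constants, and translation fixes constants, so no
exception for them is needed. -/
theorem isTranslate_affineRescale {n : ℕ} (β : Fin n → ℝ) {m : ℝ} (hm : m ≠ 0) (h : Poly n) :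
    IsTranslate β (affineRescale 1 β (m / m) h) h := by
  by_cases h0 : h.totalDegree = 0
  · rw [affineRescale, if_pos h0, div_self hm, one_smul, (totalDegree_eq_zero_iff_eq_C).1 h0,
      IsTranslate, aeval_C, algebraMap_eq]
  · rw [affineRescale_of_ne _ _ _ h0]
    exact isTranslate_affineLin β h

theorem isDegreewiseIdentical_affineRescale {n : ℕ} {α : ℝ} (hα : α ≠ 0) (c : ℝ) (h : Poly n)
    (h0 : h.totalDegree ≠ 0) : IsDegreewiseIdentical 1 α (affineRescale α 0 c h) h := by
  rw [affineRescale_of_ne _ _ _ h0]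
  exact isDegreewiseIdentical_affineLin hα h

end VCA

end

/-! ### Assembly: translation is `α = 1`, scaling is `β = 0`. -/

theorem mainTheorem2 {n : ℕ} {ι : Type*} [Fintype ι] (X : ι → Fin n → ℝ) (ε : ℝ) (hε : 0 ≤ ε)
    (β : Fin n → ℝ) (α : ℝ) (hα : α ≠ 0) (m m' : ℝ) (hm : m ≠ 0) (hm' : m' ≠ 0) :
    -- any outputs for the three inputs have the same number of polynomials at each step
    (∀ R R₁ R₂ : VCA.Output n,
      VCA.IsOutput X ε m R →
      VCA.IsOutput (fun i => X i - β) ε m R₁ →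
      VCA.IsOutput (fun i => α • X i) (|α| * ε) m' R₂ →
        VCA.SameStepCounts R R₁ ∧ VCA.SameStepCounts R R₂) ∧
    -- translation: each output for one input corresponds to an output for the other input
    (∀ R : VCA.Output n, VCA.IsOutput X ε m R →
      ∃ R₁ : VCA.Output n, VCA.IsOutput (fun i => X i - β) ε m R₁ ∧
        VCA.Corresponds (VCA.IsTranslate β) R R₁) ∧
    (∀ R₁ : VCA.Output n, VCA.IsOutput (fun i => X i - β) ε m R₁ →
      ∃ R : VCA.Output n, VCA.IsOutput X ε m R ∧
        VCA.Corresponds (VCA.IsTranslate β) R R₁) ∧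
    -- scaling: likewise, for the nonconstant polynomials
    (∀ R : VCA.Output n, VCA.IsOutput X ε m R →
      ∃ R₂ : VCA.Output n, VCA.IsOutput (fun i => α • X i) (|α| * ε) m' R₂ ∧
        VCA.Corresponds
          (fun h' h => h.totalDegree ≠ 0 → VCA.IsDegreewiseIdentical 1 α h' h) R R₂) ∧
    (∀ R₂ : VCA.Output n, VCA.IsOutput (fun i => α • X i) (|α| * ε) m' R₂ →
      ∃ R : VCA.Output n, VCA.IsOutput X ε m R ∧
        VCA.Corresponds
          (fun h' h => h.totalDegree ≠ 0 → VCA.IsDegreewiseIdentical 1 α h' h) R R₂) := by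
  have hX₁ : (fun i => X i - β) = fun i => (1 : ℝ) • (X i - β) := by simp
  have hε₁ : ε = |(1 : ℝ)| * ε := by simp
  have hX₂ : (fun i => α • X i) = fun i => α • (X i - (0 : Fin n → ℝ)) := by simp
  have htrans : ∀ R₁ : VCA.Output n, VCA.IsOutput (fun i => X i - β) ε m R₁ →
      ∃ R : VCA.Output n, VCA.IsOutput X ε m R ∧
        VCA.Corresponds (VCA.IsTranslate β) R R₁ := by
    intro R₁ h₁
    rw [hX₁, hε₁] at h₁
    exact VCA.exists_corresponds_affine_symm hε one_ne_zero hm hm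
      (VCA.isTranslate_affineRescale β hm) h₁
  have hscale : ∀ R₂ : VCA.Output n, VCA.IsOutput (fun i => α • X i) (|α| * ε) m' R₂ →
      ∃ R : VCA.Output n, VCA.IsOutput X ε m R ∧
        VCA.Corresponds
          (fun h' h => h.totalDegree ≠ 0 → VCA.IsDegreewiseIdentical 1 α h' h) R R₂ := by
    intro R₂ h₂
    rw [hX₂] at h₂
    exact VCA.exists_corresponds_affine_symm hε hα hm hm'
      (VCA.isDegreewiseIdentical_affineRescale hα _) h₂
  refine ⟨fun R R₁ R₂ hR h₁ h₂ => ⟨?_, ?_⟩, fun R hR => ?_, htrans, fun R hR => ?_, hscale⟩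
  · obtain ⟨R', hR', hc⟩ := htrans R₁ h₁
    exact (hR.sameStepCounts hε hR').trans hc.sameStepCounts
  · obtain ⟨R', hR', hc⟩ := hscale R₂ h₂
    exact (hR.sameStepCounts hε hR').trans hc.sameStepCounts
  · have := VCA.exists_corresponds_affine (β := β) (rel := VCA.IsTranslate β) hε one_ne_zero hm hm
      (VCA.isTranslate_affineRescale β hm) hR
    rwa [← hX₁, ← hε₁] at this
  · have := VCA.exists_corresponds_affine (β := 0)
      (rel := fun h' h => h.totalDegree ≠ 0 → VCA.IsDegreewiseIdentical 1 α h' h) hε hα hm hm'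
      (VCA.isDegreewiseIdentical_affineRescale hα _) hR
    rwa [← hX₂] at this
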